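/- Let $\mathrm{sign}(t)=1$ for $t\ge 0$ and $\mathrm{sign}(t)=-1$ for $t<0$ (applied entrywise to vectors), let $\lambda=\sqrt{2/\pi}$, and let $\|\cdot\|_2$ be the spectral norm of matrices. For positive integers $d_1,d_2,k$ let $\mathcal F_k\subset\mathbb R^{d_1\times d_2}$ be the set of matrices of rank at most $k$ all of whose columns have Euclidean norm $1$. Let $(\mathbf x_i,\bar{\mathbf e}_i)$, $i=1,\dots,m$, be i.i.d. random pairs such that $\mathbf x_i$ is a standard Gaussian vector in $\mathbb R^{d_1}$, $\bar{\mathbf e}_i=\sqrt{d_2}\,\mathbf e_{j_i}$ where $j_i$ is uniformly distributed on $\{1,\dots,d_2\}$ and $\mathbf e_1,\dots,\mathbf e_{d_2}$ is the standard basis of $\mathbb R^{d_2}$, and $\mathbf x_i$ and $\bar{\mathbf e}_i$ are independent. Define $\mathcal A:\mathbb R^{d_1\times d_2}\to\mathbb R^m$ by $\mathcal A(W)=(\langle \mathbf x_i\bar{\mathbf e}_i^\top,W\rangle)_{i=1}^m$, with the entrywise matrix inner product, and let $\mathcal A'(\mathbf y)=\sum_{i=1}^m y_i\,\mathbf x_i\bar{\mathbf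 e}_i^\top$ be its adjoint. **Theorem.** For every $\eta\in(0,1)$ and every constant $C'>0$ there is a constant $C>0$, depending only on $\eta$ and $C'$, such that the following holds. Let $d_1>d_2$, let $W,W'\in\mathcal F_k$ be fixed with $W\neq W'$, let $\delta>0$, let $m\ge C\,d_1d_2k^{1/2}/\delta^2$, and put $\delta'=\delta/(C' d_1^{1/2}k^{1/2})$. Then, with probability at least $1-\eta$, $$\Big\|\frac{\sqrt{d_2}}{\lambda m}\Big(\mathcal A'(\mathrm{sign}(\mathcal A(W)))-\mathcal A'(\mathrm{sign}(\mathcal A(W')))\Big)-(W-W')\Big\|_2\le\delta\,\max\big\{\|W-W'\|_2,\ \|W-W'\|_2^{1/2},\ \delta'\big\}.$$ In particular, for given $m$ one may take $\delta=\sqrt{C\,d_1d_2k^{1/2}/m}$. -/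

import Mathlib

open MeasureTheory ProbabilityTheory
-- On matrices, `‖·‖` is the spectral norm (the operator norm between Euclidean spaces).
open scoped Matrix.Norms.L2Operator

namespace OneBitSensing

/-- The signum function with the convention `sign 0 = 1`. -/
noncomputable def sign (t : ℝ) : ℝ := if 0 ≤ t then 1 else -1

/-- The matrix inner product `⟨A, B⟩ = ∑ A_{ab} B_{ab}`. -/
def inner {d₁ d₂ : ℕ} (A B : Matrix (Fin d₁) (Fin d₂) ℝ) : ℝ :=
  ∑ a, ∑ b, A a b * B a b

/-- The matrices of rank at most `k` all of whose columns have Euclidean norm one. -/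
def normalizedRankLE (d₁ d₂ k : ℕ) : Set (Matrix (Fin d₁) (Fin d₂) ℝ) :=
  {W | W.rank ≤ k ∧ ∀ j, ‖WithLp.toLp 2 (fun a => W a j)‖ = 1}

/-- The scaled one-hot vector `√d₂ • e_j`. -/
noncomputable def scaledOneHot {d₂ : ℕ} (j : Fin d₂) : Fin d₂ → ℝ :=
  √(d₂ : ℝ) • Pi.single j 1

/-- The rank-one sensing matrix `x ēᵀ`, where `ē = √d₂ • e_j`. -/
noncomputable def sensingMatrix {d₁ d₂ : ℕ} (x : Fin d₁ → ℝ) (j : Fin d₂) :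
    Matrix (Fin d₁) (Fin d₂) ℝ :=
  Matrix.vecMulVec x (scaledOneHot j)

/-- The sensing operator `𝒜(W) = (⟨x_i ē_iᵀ, W⟩)_i`. -/
noncomputable def sensing {d₁ d₂ m : ℕ} (x : Fin m → Fin d₁ → ℝ) (j : Fin m → Fin d₂)
    (W : Matrix (Fin d₁) (Fin d₂) ℝ) : Fin m → ℝ :=
  fun i => inner (sensingMatrix (x i) (j i)) W

/-- The adjoint operator `𝒜'(y) = ∑ y_i x_i ē_iᵀ`. -/
noncomputable def sensingAdjoint {d₁ d₂ m : ℕ} (x : Fin m → Fin d₁ → ℝ) (j : Fin m → Fin d₂)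
    (y : Fin m → ℝ) : Matrix (Fin d₁) (Fin d₂) ℝ :=
  ∑ i, y i • sensingMatrix (x i) (j i)

/-- `sensingAdjoint` is the adjoint of `sensing`. -/
theorem inner_sensingAdjoint {d₁ d₂ m : ℕ} (x : Fin m → Fin d₁ → ℝ) (j : Fin m → Fin d₂)
    (y : Fin m → ℝ) (W : Matrix (Fin d₁) (Fin d₂) ℝ) :
    inner (sensingAdjoint x j y) W = ∑ i, y i * sensing x j W i := by
  simp only [inner, sensingAdjoint, sensing, Matrix.sum_apply, Matrix.smul_apply, smul_eq_mul,
    Finset.sum_mul, Finset.mul_sum]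
  calc _ = ∑ a, ∑ i, ∑ b, y i * sensingMatrix (x i) (j i) a b * W a b :=
        Finset.sum_congr rfl fun a _ => Finset.sum_comm
    _ = ∑ i, ∑ a, ∑ b, y i * sensingMatrix (x i) (j i) a b * W a b := Finset.sum_comm
    _ = _ := by simp only [mul_assoc]

/-- The random model: the `m` pairs `(x_i, j_i)` are independent; in each of them `x_i` is a
standard Gaussian vector of `ℝ^{d₁}`, `j_i` (the position of the one in the one-hot vector) is
uniformly distributed, and `x_i`, `j_i` are independent. -/
structure IsSample {Ω : Type*} [MeasurableSpace Ω] (P : Measure Ω) {d₁ d₂ m : ℕ}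
    (x : Fin m → Ω → Fin d₁ → ℝ) (j : Fin m → Ω → Fin d₂) : Prop where
  law_x : ∀ i, HasLaw (x i) (Measure.pi fun _ => gaussianReal 0 1) P
  law_j : ∀ i, HasLaw (j i) (uniformOn Set.univ) P
  indep_pair : ∀ i, IndepFun (x i) (j i) P
  indep : iIndepFun (fun i ω => (x i ω, j i ω)) P

end OneBitSensing

/-!
Write `B_i = y_i x_i e_{j_i}ᵀ`, where `y_i ∈ {-2, 0, 2}` is the difference of the signs of
`⟨x_i, W e_{j_i}⟩` and `⟨x_i, W' e_{j_i}⟩`. Its mean is `β = (λ / d₂) (W - W')`, so the claim is a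
deviation bound for `A = ∑ (B_i - β)`. Its Gram matrix splits as
`Aᵀ A = ∑ (B_i - β)ᵀ (B_i - β) + ∑_{i ≠ l} (B_i - β)ᵀ (B_l - β)`. Up to terms in `β`, the first sum
is `∑ B_iᵀ B_i`, a diagonal matrix because each `B_i` has a single nonzero column; the second one is
a degenerate U-statistic of order two, so that its Frobenius norm has a second moment in which
distinct pairs are orthogonal. This gives a bound on `E ‖A‖⁴`, where the Frobenius norm of `W - W'`
enters because two unit vectors `w`, `w'` are separated by the sign of a Gaussian vector only on an
event of probability `O(‖w - w'‖)`; since `W - W'` has rank at most `2 k`, that norm is at most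
`√(2 k) ‖W - W'‖`. Markov's inequality for the fourth power concludes.
-/

namespace OneBitSensing

/-- All polynomial moments of `f` are finite. This class of integrands is closed under sums and
products, so integrability is inherited by every polynomial expression in its members. -/
def HasAllMoments {α : Type*} [MeasurableSpace α] (f : α → ℝ) (μ : Measure α) : Prop :=
  ∀ n : ℕ, MemLp f n μ

namespace HasAllMoments

variable {α : Type*} [MeasurableSpace α] {f g : α → ℝ} {μ : Measure α}

lemma memLp_two (hf : HasAllMoments f μ) : MemLp f 2 μ := mod_cast hf 2

lemma integrable (hf : HasAllMoments f μ) : Integrable f μ :=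
  memLp_one_iff_integrable.1 (mod_cast hf 1)

lemma aestronglyMeasurable (hf : HasAllMoments f μ) : AEStronglyMeasurable f μ :=
  (hf 1).aestronglyMeasurable

lemma aemeasurable (hf : HasAllMoments f μ) : AEMeasurable f μ :=
  hf.aestronglyMeasurable.aemeasurable

lemma add (hf : HasAllMoments f μ) (hg : HasAllMoments g μ) :
    HasAllMoments (fun x => f x + g x) μ := fun n => (hf n).add (hg n)

lemma sub (hf : HasAllMoments f μ) (hg : HasAllMoments g μ) :
    HasAllMoments (fun x => f x - g x) μ := fun n => (hf n).sub (hg n)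

lemma mul (hf : HasAllMoments f μ) (hg : HasAllMoments g μ) :
    HasAllMoments (fun x => f x * g x) μ := fun n => by
  have : ENNReal.HolderTriple ((2 * n : ℕ) : ENNReal) ((2 * n : ℕ) : ENNReal) n := by
    constructor
    rw [Nat.cast_mul, ENNReal.mul_inv (by simp) (by simp), ← add_mul, Nat.cast_two,
      ENNReal.inv_two_add_inv_two, one_mul]
  exact (hg (2 * n)).mul' (hf (2 * n))

lemma of_bound [IsFiniteMeasure μ] (hf : AEStronglyMeasurable f μ) (C : ℝ) (h : ∀ x, |f x| ≤ C) :
    HasAllMoments f μ := fun _ => MemLp.of_bound hf C (Filter.Eventually.of_forall h)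

lemma const [IsFiniteMeasure μ] (c : ℝ) : HasAllMoments (fun _ => c) μ := fun _ => memLp_const c

lemma pow [IsFiniteMeasure μ] (hf : HasAllMoments f μ) (n : ℕ) :
    HasAllMoments (fun x => f x ^ n) μ := by
  induction n with
  | zero => simpa only [pow_zero] using const 1
  | succ n ih => simpa only [pow_succ] using ih.mul hf

lemma sum {ι : Type*} {s : Finset ι} {F : ι → α → ℝ} (h : ∀ i ∈ s, HasAllMoments (F i) μ) :
    HasAllMoments (fun x => ∑ i ∈ s, F i x) μ := fun n => memLp_finsetSum s fun i hi => h i hi n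

lemma abs (hf : HasAllMoments f μ) : HasAllMoments (fun x => |f x|) μ := fun n => (hf n).abs

lemma comp_hasLaw {β : Type*} [MeasurableSpace β] {ν : Measure β} {X : β → α}
    (hf : HasAllMoments f μ) (hX : HasLaw X μ ν) : HasAllMoments (fun y => f (X y)) ν := fun n => by
  have h := hf n
  rw [← hX.map_eq] at h
  exact h.comp_of_map hX.aemeasurable

end HasAllMoments

section Moments

variable {Ω : Type*} [MeasurableSpace Ω] {P : Measure Ω}

lemma integral_mul_le_sqrt_mul_sqrt {f g : Ω → ℝ} (hf : MemLp f 2 P) (hg : MemLp g 2 P) :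
    ∫ ω, f ω * g ω ∂P ≤ √(∫ ω, f ω ^ 2 ∂P) * √(∫ ω, g ω ^ 2 ∂P) := by
  have holder := integral_mul_norm_le_Lp_mul_Lq (μ := P) (f := f) (g := g)
    Real.HolderConjugate.two_two (by simpa using hf) (by simpa using hg)
  calc ∫ ω, f ω * g ω ∂P ≤ ∫ ω, ‖f ω‖ * ‖g ω‖ ∂P := by
        refine integral_mono (hf.integrable_mul hg) (hf.norm.integrable_mul hg.norm) fun ω => ?_
        simpa [← abs_mul] using le_abs_self (f ω * g ω)
    _ ≤ √(∫ ω, f ω ^ 2 ∂P) * √(∫ ω, g ω ^ 2 ∂P) := by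
        simpa [Real.sqrt_eq_rpow] using holder

lemma integral_add_sq_le [IsFiniteMeasure P] {X Y : Ω → ℝ} (hX : HasAllMoments X P)
    (hY : HasAllMoments Y P) :
    ∫ ω, (X ω + Y ω) ^ 2 ∂P ≤ 2 * ∫ ω, X ω ^ 2 ∂P + 2 * ∫ ω, Y ω ^ 2 ∂P := by
  have iX := (hX.pow 2).integrable.const_mul 2
  have iY := (hY.pow 2).integrable.const_mul 2
  rw [← integral_const_mul, ← integral_const_mul, ← integral_add iX iY]
  exact integral_mono ((hX.add hY).pow 2).integrable (iX.add iY) fun ω =>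
    (add_sq_le (a := X ω) (b := Y ω)).trans_eq (mul_add _ _ _)

variable {ι : Type*} {X : ι → Ω → ℝ}

lemma indepFun_fun_sum_of_notMem (hX : ∀ i, HasAllMoments (X i) P) (hind : iIndepFun X P)
    {a : ι} {s : Finset ι} (ha : a ∉ s) : IndepFun (X a) (fun ω => ∑ i ∈ s, X i ω) P := by
  simpa only [← Finset.sum_apply] using
    (hind.indepFun_finsetSum_of_notMem₀ (fun i => (hX i).aemeasurable) ha).symm

variable [IsProbabilityMeasure P]

lemma integral_sq_le_sqrt_integral_pow_four {f : Ω → ℝ} (hf : HasAllMoments f P) :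
    ∫ ω, f ω ^ 2 ∂P ≤ √(∫ ω, f ω ^ 4 ∂P) := by
  simpa [← pow_mul] using integral_mul_le_sqrt_mul_sqrt (hf.pow 2).memLp_two
    (HasAllMoments.const (μ := P) 1).memLp_two

lemma integral_add_pow_of_indepFun {X Y : Ω → ℝ} (hX : HasAllMoments X P) (hY : HasAllMoments Y P)
    (hXY : IndepFun X Y P) (n : ℕ) :
    ∫ ω, (X ω + Y ω) ^ n ∂P
      = ∑ i ∈ Finset.range (n + 1), (∫ ω, X ω ^ i ∂P) * (∫ ω, Y ω ^ (n - i) ∂P) * n.choose i := by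
  simp only [add_pow]
  rw [integral_finsetSum _ fun i _ =>
    (((hX.pow i).mul (hY.pow (n - i))).mul (.const (n.choose i : ℝ))).integrable]
  refine Finset.sum_congr rfl fun i _ => ?_
  rw [integral_mul_const, hXY.integral_fun_comp_mul_comp (f := (· ^ i)) (g := (· ^ (n - i)))
    hX.aemeasurable hY.aemeasurable (by fun_prop) (by fun_prop)]

lemma integral_sum_sq_le (hX : ∀ i, HasAllMoments (X i) P) (hind : iIndepFun X P)
    (centred : ∀ i, ∫ ω, X i ω ∂P = 0) {V : ℝ} (hV : ∀ i, ∫ ω, X i ω ^ 2 ∂P ≤ V) (s : Finset ι) :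
    ∫ ω, (∑ i ∈ s, X i ω) ^ 2 ∂P ≤ V * s.card := by
  classical
  induction s using Finset.induction_on with
  | empty => simp
  | insert a s ha ih =>
    have expand : ∫ ω, (X a ω + ∑ i ∈ s, X i ω) ^ 2 ∂P
        = (∫ ω, X a ω ^ 2 ∂P) + ∫ ω, (∑ i ∈ s, X i ω) ^ 2 ∂P := by
      rw [integral_add_pow_of_indepFun (hX a) (.sum fun i _ => hX i)
        (indepFun_fun_sum_of_notMem hX hind ha)]
      simp [Finset.sum_range_succ, centred]
      ring
    rw [Finset.card_insert_of_notMem ha]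
    simp only [Finset.sum_insert ha]
    push_cast
    linarith [hV a]

lemma integral_sum_pow_four_le (hX : ∀ i, HasAllMoments (X i) P) (hind : iIndepFun X P)
    (centred : ∀ i, ∫ ω, X i ω ∂P = 0) {M : ℝ} (hM : ∀ i, ∫ ω, X i ω ^ 4 ∂P ≤ M) (s : Finset ι) :
    ∫ ω, (∑ i ∈ s, X i ω) ^ 4 ∂P ≤ 3 * M * (s.card : ℝ) ^ 2 := by
  classical
  induction s using Finset.induction_on with
  | empty => simp
  | insert a s ha ih =>
    have second (i : ι) : ∫ ω, X i ω ^ 2 ∂P ≤ √M :=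
      (integral_sq_le_sqrt_integral_pow_four (hX i)).trans (Real.sqrt_le_sqrt (hM i))
    have hS : ∫ ω, ∑ i ∈ s, X i ω ∂P = 0 := by
      simp [integral_finsetSum _ fun i _ => (hX i).integrable, centred]
    have expand : ∫ ω, (X a ω + ∑ i ∈ s, X i ω) ^ 4 ∂P = (∫ ω, X a ω ^ 4 ∂P)
        + 6 * ((∫ ω, X a ω ^ 2 ∂P) * ∫ ω, (∑ i ∈ s, X i ω) ^ 2 ∂P)
        + ∫ ω, (∑ i ∈ s, X i ω) ^ 4 ∂P := by
      rw [integral_add_pow_of_indepFun (hX a) (.sum fun i _ => hX i)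
        (indepFun_fun_sum_of_notMem hX hind ha)]
      simp [Finset.sum_range_succ, centred, hS, Nat.choose]
      ring
    have hM0 : 0 ≤ M := (integral_nonneg fun ω => by positivity).trans (hM a)
    have cross : (∫ ω, X a ω ^ 2 ∂P) * ∫ ω, (∑ i ∈ s, X i ω) ^ 2 ∂P ≤ M * s.card := calc
      _ ≤ √M * (√M * s.card) :=
        mul_le_mul (second a) (integral_sum_sq_le hX hind centred second s)
          (integral_nonneg fun ω => sq_nonneg _) (Real.sqrt_nonneg M)
      _ = M * s.card := by rw [← mul_assoc, Real.mul_self_sqrt hM0]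
    rw [Finset.card_insert_of_notMem ha]
    simp only [Finset.sum_insert ha]
    push_cast
    linarith [hM a]

end Moments

section Gaussian

lemma hasAllMoments_id_gaussianReal (v : NNReal) :
    HasAllMoments (fun t => t) (gaussianReal 0 v) := fun n => memLp_id_gaussianReal' n (by simp)

lemma integrable_pow_mul_gaussianPDFReal {v : NNReal} (hv : v ≠ 0) (n : ℕ) :
    Integrable fun t => t ^ n * gaussianPDFReal 0 v t := by
  have h := ((hasAllMoments_id_gaussianReal v).pow n).integrable
  rw [gaussianReal_of_var_ne_zero 0 hv, integrable_withDensity_iff (measurable_gaussianPDF 0 v)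
    (ae_of_all _ fun _ => gaussianPDF_lt_top)] at h
  simpa only [toReal_gaussianPDF] using h

lemma hasDerivAt_gaussianPDFReal_zero {v : NNReal} (t : ℝ) :
    HasDerivAt (gaussianPDFReal 0 v) (-(t / v) * gaussianPDFReal 0 v t) t := by
  have : HasDerivAt (fun t : ℝ => -(t - 0) ^ 2 / (2 * v)) (-(t / v)) t := by
    refine ((((hasDerivAt_id t).sub_const 0).pow 2).neg.div_const (2 * v : ℝ)).congr_deriv ?_
    simp
    ring
  rw [gaussianPDFReal_def]
  exact (this.exp.const_mul _).congr_deriv (by ring)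

lemma integral_pow_add_two_gaussianReal (v : NNReal) (n : ℕ) :
    ∫ t, t ^ (n + 2) ∂gaussianReal 0 v = (n + 1) * v * ∫ t, t ^ n ∂gaussianReal 0 v := by
  rcases eq_or_ne v 0 with rfl | hv
  · simp
  have hv' : (v : ℝ) ≠ 0 := NNReal.coe_ne_zero.2 hv
  have deriv (t : ℝ) : HasDerivAt (fun t => t ^ (n + 1) * gaussianPDFReal 0 v t)
      ((n + 1) * (t ^ n * gaussianPDFReal 0 v t) - t ^ (n + 2) * gaussianPDFReal 0 v t / v) t :=
    ((hasDerivAt_pow (n + 1) t).mul (hasDerivAt_gaussianPDFReal_zero t)).congr_deriv (by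
      push_cast [Nat.add_sub_cancel]
      ring)
  have parts := integral_eq_zero_of_hasDerivAt_of_integrable deriv
    (((integrable_pow_mul_gaussianPDFReal hv n).const_mul _).sub
      ((integrable_pow_mul_gaussianPDFReal hv (n + 2)).div_const _))
    (integrable_pow_mul_gaussianPDFReal hv (n + 1))
  rw [integral_sub ((integrable_pow_mul_gaussianPDFReal hv n).const_mul _)
    ((integrable_pow_mul_gaussianPDFReal hv (n + 2)).div_const _), integral_const_mul,
    integral_div, sub_eq_zero, eq_div_iff hv'] at parts
  simp only [integral_gaussianReal_eq_integral_smul hv, smul_eq_mul,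
    mul_comm (gaussianPDFReal _ _ _)]
  rw [← parts]
  ring

lemma integral_sq_gaussianReal (v : NNReal) : ∫ t, t ^ 2 ∂gaussianReal 0 v = v := by
  simpa using integral_pow_add_two_gaussianReal v 0

lemma integral_pow_four_gaussianReal (v : NNReal) :
    ∫ t, t ^ 4 ∂gaussianReal 0 v = 3 * v ^ 2 := by
  rw [integral_pow_add_two_gaussianReal, integral_sq_gaussianReal]
  norm_num
  ring

lemma integral_pow_eight_gaussianReal (v : NNReal) :
    ∫ t, t ^ 8 ∂gaussianReal 0 v = 105 * v ^ 4 := by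
  rw [integral_pow_add_two_gaussianReal, integral_pow_add_two_gaussianReal,
    integral_pow_four_gaussianReal]
  norm_num
  ring

lemma integral_sq_sub_one_pow_four_gaussianReal :
    ∫ t, (t ^ 2 - 1) ^ 4 ∂gaussianReal 0 1 = 60 := by
  have hpow (c : ℝ) (n : ℕ) : Integrable (fun t : ℝ => c * t ^ n) (gaussianReal 0 1) :=
    ((hasAllMoments_id_gaussianReal 1).pow n).integrable.const_mul c
  have expand (t : ℝ) : (t ^ 2 - 1) ^ 4
      = 1 * t ^ 8 + (-4) * t ^ 6 + 6 * t ^ 4 + (-4) * t ^ 2 + 1 := by ring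
  simp only [expand]
  rw [integral_add (by fun_prop) (integrable_const _), integral_add (by fun_prop) (hpow _ _),
    integral_add (by fun_prop) (hpow _ _), integral_add (hpow _ _) (hpow _ _)]
  simp only [integral_const_mul, integral_pow_eight_gaussianReal,
    integral_pow_add_two_gaussianReal 1 4, integral_pow_four_gaussianReal,
    integral_sq_gaussianReal]
  norm_num

lemma gaussianPDFReal_zero_one_le_half (t : ℝ) : gaussianPDFReal 0 1 t ≤ 1 / 2 := by
  have sqrt_two_pi : 2 ≤ √(2 * Real.pi) :=
    Real.le_sqrt_of_sq_le (by linarith [Real.pi_gt_three])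
  have exp_le : Real.exp (-(t ^ 2) / 2) ≤ 1 := Real.exp_le_one_iff.2 (by nlinarith [sq_nonneg t])
  calc gaussianPDFReal 0 1 t = (√(2 * Real.pi))⁻¹ * Real.exp (-(t ^ 2) / 2) := by
        simp [gaussianPDFReal]
    _ ≤ 2⁻¹ * 1 := by gcongr
    _ = 1 / 2 := by norm_num

lemma gaussianReal_abs_le_le {s : ℝ} (hs : 0 ≤ s) :
    (gaussianReal 0 1).real {t | |t| ≤ s} ≤ s := by
  have hset : {t : ℝ | |t| ≤ s} = Set.Icc (-s) s := by ext t; simp [abs_le]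
  rw [measureReal_def, gaussianReal_apply_eq_integral 0 one_ne_zero, hset,
    ENNReal.toReal_ofReal (integral_nonneg fun t => gaussianPDFReal_nonneg 0 1 t)]
  calc ∫ t in Set.Icc (-s) s, gaussianPDFReal 0 1 t
      ≤ ∫ _ in Set.Icc (-s) s, (1 / 2 : ℝ) :=
        integral_mono (integrable_gaussianPDFReal 0 1).integrableOn (by simp)
          gaussianPDFReal_zero_one_le_half
    _ = s := by
        rw [setIntegral_const, Real.volume_real_Icc_of_le (by linarith), smul_eq_mul]
        ring

lemma integral_abs_gaussianReal : ∫ t, |t| ∂gaussianReal 0 1 = √(2 / Real.pi) := by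
  have hpdf (t : ℝ) : gaussianPDFReal 0 1 t • |t|
      = (√(2 * Real.pi))⁻¹ * (|t| * Real.exp (-(1 / 2) * |t| ^ 2)) := by
    simp only [gaussianPDFReal, smul_eq_mul, sq_abs, NNReal.coe_one, mul_one, sub_zero,
      neg_div, neg_mul, div_mul_eq_mul_div, one_mul]
    ring
  have half : ∫ s in Set.Ioi (0 : ℝ), s * Real.exp (-(1 / 2) * s ^ 2) = 1 := by
    have := integral_rpow_mul_exp_neg_mul_rpow (p := 2) (q := 1) (b := 1 / 2) (by norm_num)
      (by norm_num) (by norm_num)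
    norm_num at this
    simpa only [neg_mul] using this
  have sqrt_pi : √Real.pi ≠ 0 := (Real.sqrt_pos.2 Real.pi_pos).ne'
  rw [integral_gaussianReal_eq_integral_smul one_ne_zero]
  simp only [hpdf]
  rw [integral_const_mul, integral_comp_abs (f := fun s => s * Real.exp (-(1 / 2) * s ^ 2)), half,
    Real.sqrt_div' _ Real.pi_pos.le, Real.sqrt_mul zero_le_two]
  field_simp
  norm_num

variable {ι : Type*} [Fintype ι]

variable (ι) in
/-- The law of a standard Gaussian vector indexed by `ι`. -/
noncomputable abbrev gaussianPi : Measure (ι → ℝ) := Measure.pi fun _ => gaussianReal 0 1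

lemma hasLaw_eval_gaussianPi (a : ι) :
    HasLaw (fun x : ι → ℝ => x a) (gaussianReal 0 1) (gaussianPi ι) :=
  (measurePreserving_eval (fun _ : ι => gaussianReal 0 1) a).hasLaw

lemma iIndepFun_eval_gaussianPi : iIndepFun (fun (a : ι) (x : ι → ℝ) => x a) (gaussianPi ι) :=
  (iIndepFun_iff_hasLaw_pi_pi hasLaw_eval_gaussianPi).2 HasLaw.id

lemma hasGaussianLaw_id_gaussianPi : HasGaussianLaw (fun x : ι → ℝ => x) (gaussianPi ι) :=
  iIndepFun_eval_gaussianPi.hasGaussianLaw fun a => (hasLaw_eval_gaussianPi a).hasGaussianLaw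

lemma hasAllMoments_eval_gaussianPi (a : ι) :
    HasAllMoments (fun x : ι → ℝ => x a) (gaussianPi ι) :=
  (hasAllMoments_id_gaussianReal 1).comp_hasLaw (hasLaw_eval_gaussianPi a)

lemma hasAllMoments_dotProduct (u : ι → ℝ) : HasAllMoments (fun x => x ⬝ᵥ u) (gaussianPi ι) :=
  .sum fun a _ => (hasAllMoments_eval_gaussianPi a).mul (.const (u a))

lemma hasAllMoments_dotProduct_self : HasAllMoments (fun x => x ⬝ᵥ x) (gaussianPi ι) :=
  .sum fun a _ => (hasAllMoments_eval_gaussianPi a).mul (hasAllMoments_eval_gaussianPi a)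

lemma integral_eval_gaussianPi_comp (a : ι) {f : ℝ → ℝ} (hf : Measurable f) :
    ∫ x, f (x a) ∂gaussianPi ι = ∫ t, f t ∂gaussianReal 0 1 :=
  (hasLaw_eval_gaussianPi a).integral_comp hf.aestronglyMeasurable

lemma integral_eval_gaussianPi (a : ι) : ∫ x, x a ∂gaussianPi ι = 0 := by
  rw [(hasLaw_eval_gaussianPi a).integral_eq, integral_id_gaussianReal]

lemma integral_dotProduct_gaussianPi (u : ι → ℝ) : ∫ x, x ⬝ᵥ u ∂gaussianPi ι = 0 := by
  simp only [dotProduct]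
  rw [integral_finsetSum _ fun a _ =>
    ((hasAllMoments_eval_gaussianPi a).mul (.const _)).integrable]
  simp only [integral_mul_const, integral_eval_gaussianPi, zero_mul, Finset.sum_const_zero]

lemma covariance_eval_gaussianPi [DecidableEq ι] (a b : ι) :
    cov[fun x => x a, fun x => x b; gaussianPi ι] = if a = b then 1 else 0 := by
  split_ifs with h
  · rw [h, covariance_self (hasLaw_eval_gaussianPi b).aemeasurable,
      (hasLaw_eval_gaussianPi b).variance_eq, variance_id_gaussianReal, NNReal.coe_one]
  · exact (iIndepFun_eval_gaussianPi.indepFun h).covariance_eq_zero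
      (hasAllMoments_eval_gaussianPi a).memLp_two (hasAllMoments_eval_gaussianPi b).memLp_two

lemma covariance_dotProduct (u v : ι → ℝ) :
    cov[fun x => x ⬝ᵥ u, fun x => x ⬝ᵥ v; gaussianPi ι] = u ⬝ᵥ v := by
  classical
  have hmem (c : ℝ) (a : ι) : MemLp (fun x : ι → ℝ => x a * c) 2 (gaussianPi ι) :=
    ((hasAllMoments_eval_gaussianPi a).mul (.const c)).memLp_two
  simp only [dotProduct]
  rw [covariance_fun_sum_fun_sum (fun a => hmem _ a) (fun a => hmem _ a)]
  simp [covariance_mul_const_left, covariance_mul_const_right, covariance_eval_gaussianPi]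

lemma dotProduct_self_nonneg (u : ι → ℝ) : 0 ≤ u ⬝ᵥ u := dotProduct_self_star_nonneg u

lemma hasLaw_dotProduct (u : ι → ℝ) :
    HasLaw (fun x => x ⬝ᵥ u) (gaussianReal 0 (u ⬝ᵥ u).toNNReal) (gaussianPi ι) where
  aemeasurable := (hasAllMoments_dotProduct u).aemeasurable
  map_eq := by
    let L : (ι → ℝ) →L[ℝ] ℝ := (dotProductBilin ℝ ℝ).flip u |>.toContinuousLinearMap
    have h : HasGaussianLaw (fun x => x ⬝ᵥ u) (gaussianPi ι) :=
      hasGaussianLaw_id_gaussianPi.map_fun L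
    rw [h.map_eq_gaussianReal, ← covariance_self h.aemeasurable, covariance_dotProduct,
      integral_dotProduct_gaussianPi]

lemma integral_dotProduct_pow (u : ι → ℝ) (n : ℕ) :
    ∫ x, (x ⬝ᵥ u) ^ n ∂gaussianPi ι = ∫ t, t ^ n ∂gaussianReal 0 (u ⬝ᵥ u).toNNReal :=
  (hasLaw_dotProduct u).integral_comp (f := (· ^ n)) (by fun_prop)

lemma integral_dotProduct_sq (u : ι → ℝ) : ∫ x, (x ⬝ᵥ u) ^ 2 ∂gaussianPi ι = u ⬝ᵥ u := by
  rw [integral_dotProduct_pow, integral_sq_gaussianReal,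
    Real.coe_toNNReal _ (dotProduct_self_nonneg u)]

lemma integral_dotProduct_pow_four (u : ι → ℝ) :
    ∫ x, (x ⬝ᵥ u) ^ 4 ∂gaussianPi ι = 3 * (u ⬝ᵥ u) ^ 2 := by
  rw [integral_dotProduct_pow, integral_pow_four_gaussianReal,
    Real.coe_toNNReal _ (dotProduct_self_nonneg u)]

lemma integral_dotProduct_pow_eight (u : ι → ℝ) :
    ∫ x, (x ⬝ᵥ u) ^ 8 ∂gaussianPi ι = 105 * (u ⬝ᵥ u) ^ 4 := by
  rw [integral_dotProduct_pow, integral_pow_eight_gaussianReal,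
    Real.coe_toNNReal _ (dotProduct_self_nonneg u)]

lemma integral_normSq_sub_card_pow_four_le :
    ∫ x, (x ⬝ᵥ x - Fintype.card ι) ^ 4 ∂gaussianPi ι ≤ 180 * (Fintype.card ι : ℝ) ^ 2 := by
  have mom (a : ι) : HasAllMoments (fun x : ι → ℝ => x a ^ 2 - 1) (gaussianPi ι) :=
    ((hasAllMoments_eval_gaussianPi a).pow 2).sub (.const 1)
  have centred (a : ι) : ∫ x : ι → ℝ, (x a ^ 2 - 1) ∂gaussianPi ι = 0 := by
    rw [integral_eval_gaussianPi_comp a (f := fun t => t ^ 2 - 1) (by fun_prop),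
      integral_sub ((hasAllMoments_id_gaussianReal 1).pow 2).integrable (integrable_const 1),
      integral_sq_gaussianReal]
    simp
  have fourth (a : ι) : ∫ x : ι → ℝ, (x a ^ 2 - 1) ^ 4 ∂gaussianPi ι ≤ 60 :=
    (integral_eval_gaussianPi_comp a (f := fun t => (t ^ 2 - 1) ^ 4) (by fun_prop)).trans_le
      integral_sq_sub_one_pow_four_gaussianReal.le
  have hsum (x : ι → ℝ) : x ⬝ᵥ x - Fintype.card ι = ∑ a, (x a ^ 2 - 1) := by
    simp [dotProduct, Finset.sum_sub_distrib, sq]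
  simp only [hsum]
  refine (integral_sum_pow_four_le mom (iIndepFun_eval_gaussianPi.comp (fun _ t => t ^ 2 - 1)
    fun _ => by fun_prop) centred fourth Finset.univ).trans_eq ?_
  rw [Finset.card_univ]
  ring

lemma integral_normSq_sub_card_sq_le :
    ∫ x, (x ⬝ᵥ x - Fintype.card ι) ^ 2 ∂gaussianPi ι ≤ 14 * Fintype.card ι := by
  refine (integral_sq_le_sqrt_integral_pow_four
    (hasAllMoments_dotProduct_self.sub (.const _))).trans (Real.sqrt_le_iff.2 ⟨by positivity, ?_⟩)
  refine integral_normSq_sub_card_pow_four_le.trans ?_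
  rw [mul_pow]
  gcongr
  norm_num

/-- The component of `x` orthogonal to the unit vector `w`. -/
def orthPart (w x : ι → ℝ) : ι → ℝ := x - (x ⬝ᵥ w) • w

lemma measurable_orthPart (w : ι → ℝ) : Measurable (orthPart w) := by
  unfold orthPart
  fun_prop

lemma orthPart_apply (w x : ι → ℝ) (a : ι) : orthPart w x a = x a - (x ⬝ᵥ w) * w a := rfl

lemma orthPart_dotProduct_comm (w x u : ι → ℝ) : orthPart w x ⬝ᵥ u = x ⬝ᵥ orthPart w u := by
  simp only [orthPart, sub_dotProduct, dotProduct_sub, smul_dotProduct, dotProduct_smul,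
    smul_eq_mul, dotProduct_comm u w, mul_comm]

lemma orthPart_dotProduct (w x u : ι → ℝ) :
    orthPart w x ⬝ᵥ u = x ⬝ᵥ u - (x ⬝ᵥ w) * (w ⬝ᵥ u) := by
  simp only [orthPart, sub_dotProduct, smul_dotProduct, smul_eq_mul]

lemma orthPart_dotProduct_self {w : ι → ℝ} (hw : w ⬝ᵥ w = 1) (x : ι → ℝ) :
    orthPart w x ⬝ᵥ orthPart w x = x ⬝ᵥ x - (x ⬝ᵥ w) ^ 2 := by
  simp only [orthPart, sub_dotProduct, dotProduct_sub, smul_dotProduct, dotProduct_smul, hw,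
    smul_eq_mul, dotProduct_comm w x]
  ring

lemma orthPart_dotProduct_self_le {w : ι → ℝ} (hw : w ⬝ᵥ w = 1) (x : ι → ℝ) :
    orthPart w x ⬝ᵥ orthPart w x ≤ x ⬝ᵥ x :=
  (orthPart_dotProduct_self hw x).trans_le (sub_le_self _ (sq_nonneg _))

lemma sub_dotProduct_sub_self {w w' : ι → ℝ} (hw : w ⬝ᵥ w = 1) (hw' : w' ⬝ᵥ w' = 1) :
    (w - w') ⬝ᵥ (w - w') = 2 - 2 * (w ⬝ᵥ w') := by
  simp only [sub_dotProduct, dotProduct_sub, hw, hw', dotProduct_comm w' w]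
  ring

lemma hasLaw_dotProduct_of_unit {w : ι → ℝ} (hw : w ⬝ᵥ w = 1) :
    HasLaw (fun x => x ⬝ᵥ w) (gaussianReal 0 1) (gaussianPi ι) := by
  simpa [hw] using hasLaw_dotProduct w

lemma indepFun_dotProduct_orthPart {w : ι → ℝ} (hw : w ⬝ᵥ w = 1) :
    IndepFun (fun x => x ⬝ᵥ w) (orthPart w) (gaussianPi ι) := by
  classical
  let L : (ι → ℝ) →L[ℝ] (Unit → ℝ) × (ι → ℝ) := LinearMap.toContinuousLinearMap
    { toFun := fun x => (fun _ => x ⬝ᵥ w, orthPart w x)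
      map_add' := fun x y => by ext <;> simp [orthPart_apply]; ring
      map_smul' := fun c x => by ext <;> simp [orthPart_apply]; ring }
  have gaussian : HasGaussianLaw (fun x => ((fun _ => x ⬝ᵥ w : Unit → ℝ), fun a => orthPart w x a))
      (gaussianPi ι) := hasGaussianLaw_id_gaussianPi.map_fun L
  have coord (a : ι) : (fun x => orthPart w x a) = fun x => x ⬝ᵥ orthPart w (Pi.single a 1) := by
    ext x
    rw [← orthPart_dotProduct_comm, dotProduct_single, mul_one]
  have uncorrelated (a : ι) :
      cov[fun x => x ⬝ᵥ w, fun x => orthPart w x a; gaussianPi ι] = 0 := by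
    rw [coord, covariance_dotProduct, ← orthPart_dotProduct_comm, orthPart_dotProduct, hw]
    ring
  have indep := gaussian.indepFun_of_covariance_eval (X := fun _ x => x ⬝ᵥ w)
    (Y := fun a x => orthPart w x a) fun _ a => uncorrelated a
  exact indep.comp (φ := fun f : Unit → ℝ => f ()) (ψ := id) (by fun_prop) measurable_id

lemma hasAllMoments_orthPart_dotProduct (w u : ι → ℝ) :
    HasAllMoments (fun x => orthPart w x ⬝ᵥ u) (gaussianPi ι) := by
  simpa only [orthPart_dotProduct_comm] using hasAllMoments_dotProduct (orthPart w u)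

lemma integral_orthPart_dotProduct_pow_four_le {w : ι → ℝ} (hw : w ⬝ᵥ w = 1) (u : ι → ℝ) :
    ∫ x, (orthPart w x ⬝ᵥ u) ^ 4 ∂gaussianPi ι ≤ 3 * (u ⬝ᵥ u) ^ 2 := by
  simp only [orthPart_dotProduct_comm w _ u, integral_dotProduct_pow_four]
  gcongr
  exacts [dotProduct_self_nonneg (orthPart w u), orthPart_dotProduct_self_le hw u]

lemma integral_orthPart_dotProduct_pow_eight_le {w : ι → ℝ} (hw : w ⬝ᵥ w = 1) (u : ι → ℝ) :
    ∫ x, (orthPart w x ⬝ᵥ u) ^ 8 ∂gaussianPi ι ≤ 105 * (u ⬝ᵥ u) ^ 4 := by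
  simp only [orthPart_dotProduct_comm w _ u, integral_dotProduct_pow_eight]
  gcongr
  exacts [dotProduct_self_nonneg (orthPart w u), orthPart_dotProduct_self_le hw u]

lemma integral_normSq_orthPart_sub_card_pow_four_le {w : ι → ℝ} (hw : w ⬝ᵥ w = 1) :
    ∫ x, (orthPart w x ⬝ᵥ orthPart w x - Fintype.card ι) ^ 4 ∂gaussianPi ι
      ≤ 1440 * (Fintype.card ι : ℝ) ^ 2 + 840 := by
  have mN : HasAllMoments (fun x => x ⬝ᵥ x - (Fintype.card ι : ℝ)) (gaussianPi ι) :=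
    hasAllMoments_dotProduct_self.sub (.const _)
  have mw := hasAllMoments_dotProduct w
  have split (p q : ℝ) : (p - q ^ 2) ^ 4 ≤ 8 * p ^ 4 + 8 * q ^ 8 := by
    have h := Even.add_pow_le (n := 4) (by decide) (a := p) (b := -q ^ 2)
    norm_num at h
    linarith [show (q ^ 2) ^ 4 = q ^ 8 by ring]
  calc ∫ x, (orthPart w x ⬝ᵥ orthPart w x - Fintype.card ι) ^ 4 ∂gaussianPi ι
      ≤ ∫ x, 8 * (x ⬝ᵥ x - Fintype.card ι) ^ 4 + 8 * (x ⬝ᵥ w) ^ 8 ∂gaussianPi ι := by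
        simp only [orthPart_dotProduct_self hw, sub_right_comm]
        exact integral_mono ((mN.sub (mw.pow 2)).pow 4).integrable
          (((mN.pow 4).integrable.const_mul 8).add ((mw.pow 8).integrable.const_mul 8))
          fun x => split _ _
    _ = 8 * (∫ x, (x ⬝ᵥ x - Fintype.card ι) ^ 4 ∂gaussianPi ι) + 840 := by
        rw [integral_add ((mN.pow 4).integrable.const_mul 8) ((mw.pow 8).integrable.const_mul 8),
          integral_const_mul, integral_const_mul, integral_dotProduct_pow_eight, hw]
        norm_num
    _ ≤ 1440 * (Fintype.card ι : ℝ) ^ 2 + 840 := by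
        linarith [integral_normSq_sub_card_pow_four_le (ι := ι)]

lemma measurable_sign : Measurable sign :=
  Measurable.ite measurableSet_Ici measurable_const measurable_const

lemma sign_mul_self (t : ℝ) : sign t * t = |t| := by
  unfold sign
  split_ifs with h
  · rw [abs_of_nonneg h, one_mul]
  · rw [abs_of_neg (not_le.1 h), neg_one_mul]

lemma abs_sign (t : ℝ) : |sign t| = 1 := by
  unfold sign; split_ifs <;> simp

lemma integral_sign_mul_eval {w : ι → ℝ} (hw : w ⬝ᵥ w = 1) (a : ι) :
    ∫ x, sign (x ⬝ᵥ w) * x a ∂gaussianPi ι = √(2 / Real.pi) * w a := by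
  have mw := hasAllMoments_dotProduct w
  have msign : HasAllMoments (fun x => sign (x ⬝ᵥ w)) (gaussianPi ι) :=
    .of_bound (measurable_sign.comp (by fun_prop)).aestronglyMeasurable 1 fun x => (abs_sign _).le
  have morth : HasAllMoments (fun x => orthPart w x a) (gaussianPi ι) :=
    (hasAllMoments_eval_gaussianPi a).sub (mw.mul (.const (w a)))
  have split (x : ι → ℝ) :
      sign (x ⬝ᵥ w) * x a = w a * |x ⬝ᵥ w| + sign (x ⬝ᵥ w) * orthPart w x a := by
    rw [← sign_mul_self, orthPart_apply]
    ring
  have parallel : ∫ x, |x ⬝ᵥ w| ∂gaussianPi ι = √(2 / Real.pi) :=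
    ((hasLaw_dotProduct_of_unit hw).integral_comp (f := fun t => |t|) (by fun_prop)).trans
      integral_abs_gaussianReal
  have orth : ∫ x, orthPart w x a ∂gaussianPi ι = 0 := by
    simp only [orthPart_apply]
    rw [integral_sub (hasAllMoments_eval_gaussianPi a).integrable (mw.mul (.const _)).integrable,
      integral_mul_const, integral_eval_gaussianPi, integral_dotProduct_gaussianPi, zero_mul,
      sub_zero]
  have indep := (indepFun_dotProduct_orthPart hw).integral_fun_comp_mul_comp (f := sign)
    (g := fun y => y a) mw.aemeasurable (measurable_orthPart w).aemeasurable
    measurable_sign.aestronglyMeasurable (measurable_pi_apply a).aestronglyMeasurable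
  simp only [split]
  rw [integral_add ((HasAllMoments.const _).mul mw.abs).integrable (msign.mul morth).integrable,
    integral_const_mul, parallel, indep, orth, mul_zero, add_zero, mul_comm]

/-- The discrepancy `sign ⟨x, w⟩ - sign ⟨x, w'⟩` of the one-bit measurements of `w` and `w'`. -/
noncomputable def signGap (w w' x : ι → ℝ) : ℝ := sign (x ⬝ᵥ w) - sign (x ⬝ᵥ w')

lemma measurable_signGap (w w' : ι → ℝ) : Measurable (signGap w w') :=
  (measurable_sign.comp (by fun_prop)).sub (measurable_sign.comp (by fun_prop))

lemma signGap_sq_le (w w' x : ι → ℝ) : signGap w w' x ^ 2 ≤ 4 := by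
  unfold signGap sign; split_ifs <;> norm_num

lemma signGap_pow_four (w w' x : ι → ℝ) : signGap w w' x ^ 4 = 4 * signGap w w' x ^ 2 := by
  unfold signGap sign; split_ifs <;> norm_num

lemma hasAllMoments_signGap (w w' : ι → ℝ) : HasAllMoments (signGap w w') (gaussianPi ι) :=
  .of_bound (measurable_signGap w w').aestronglyMeasurable 2 fun x =>
    abs_le_of_sq_le_sq ((signGap_sq_le w w' x).trans (by norm_num)) zero_le_two

lemma integral_signGap_mul_eval {w w' : ι → ℝ} (hw : w ⬝ᵥ w = 1) (hw' : w' ⬝ᵥ w' = 1) (a : ι) :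
    ∫ x, signGap w w' x * x a ∂gaussianPi ι = √(2 / Real.pi) * (w a - w' a) := by
  have mom (v : ι → ℝ) : HasAllMoments (fun x => sign (x ⬝ᵥ v) * x a) (gaussianPi ι) :=
    (HasAllMoments.of_bound (measurable_sign.comp (by fun_prop)).aestronglyMeasurable 1
      fun x => (abs_sign _).le).mul (hasAllMoments_eval_gaussianPi a)
  simp only [signGap, sub_mul]
  rw [integral_sub (mom w).integrable (mom w').integrable, integral_sign_mul_eval hw,
    integral_sign_mul_eval hw', mul_sub]

lemma dotProduct_mul_dotProduct_nonpos_of_signGap_ne_zero {w w' x : ι → ℝ}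
    (h : signGap w w' x ≠ 0) : (x ⬝ᵥ w) * (x ⬝ᵥ w') ≤ 0 := by
  unfold signGap sign at h
  split_ifs at h with h₁ h₂ h₂
  · simp at h
  · exact mul_nonpos_of_nonneg_of_nonpos h₁ (not_le.1 h₂).le
  · exact mul_nonpos_of_nonpos_of_nonneg (not_le.1 h₁).le h₂
  · simp at h

lemma abs_dotProduct_le_of_signGap_ne_zero {w w' x : ι → ℝ} (hc : 1 / 2 ≤ w ⬝ᵥ w')
    (h : signGap w w' x ≠ 0) : |x ⬝ᵥ w| ≤ 2 * |orthPart w x ⬝ᵥ w'| := by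
  have opposite := dotProduct_mul_dotProduct_nonpos_of_signGap_ne_zero h
  rw [orthPart_dotProduct]
  rcases (abs_nonneg (x ⬝ᵥ w)).eq_or_lt with h₀ | h₀
  · rw [← h₀]; positivity
  · refine le_of_mul_le_mul_left ?_ h₀
    have := neg_abs_le ((x ⬝ᵥ w) * (x ⬝ᵥ w' - (x ⬝ᵥ w) * (w ⬝ᵥ w')))
    rw [abs_mul] at this
    nlinarith [abs_mul_abs_self (x ⬝ᵥ w), mul_self_nonneg (x ⬝ᵥ w)]

lemma setIntegral_prod_strip_le {β : Type*} [MeasurableSpace β] {ν : Measure β} [SFinite ν]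
    {f F : β → ℝ} (mf : Measurable f) (hf : ∀ y, 0 ≤ f y) (hF : ∀ y, 0 ≤ F y)
    (iF : Integrable F ν) (ifF : Integrable (fun y => f y * F y) ν) :
    ∫ p in {p : ℝ × β | |p.1| ≤ f p.2}, F p.2 ∂(gaussianReal 0 1).prod ν
      ≤ ∫ y, f y * F y ∂ν := by
  have strip : MeasurableSet {p : ℝ × β | |p.1| ≤ f p.2} :=
    measurableSet_le (by fun_prop) (by fun_prop)
  have iG := (iF.comp_snd (gaussianReal 0 1)).indicator strip
  rw [← integral_indicator strip, integral_prod_symm _ iG]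
  refine integral_mono iG.integral_prod_right ifF fun y => ?_
  have slice (t : ℝ) : {p : ℝ × β | |p.1| ≤ f p.2}.indicator (fun p => F p.2) (t, y)
      = {t : ℝ | |t| ≤ f y}.indicator (fun _ => F y) t := rfl
  simp only [slice]
  rw [integral_indicator_const _ (measurableSet_le (by fun_prop) (by fun_prop))]
  exact mul_le_mul_of_nonneg_right (gaussianReal_abs_le_le (hf y)) (hF y)

lemma setIntegral_strip_le_of_indepFun {Ω β : Type*} [MeasurableSpace Ω] [MeasurableSpace β]
    {P : Measure Ω} [IsProbabilityMeasure P] {g : Ω → ℝ} {Y : Ω → β} {f F : β → ℝ}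
    (hg : HasLaw g (gaussianReal 0 1) P) (hY : AEMeasurable Y P) (hind : IndepFun g Y P)
    (mf : Measurable f) (mF : Measurable F) (hf : ∀ y, 0 ≤ f y) (hF : ∀ y, 0 ≤ F y)
    (iF : Integrable (fun ω => F (Y ω)) P) (ifF : Integrable (fun ω => f (Y ω) * F (Y ω)) P) :
    ∫ ω in {ω | |g ω| ≤ f (Y ω)}, F (Y ω) ∂P ≤ ∫ ω, f (Y ω) * F (Y ω) ∂P := by
  have lawY : HasLaw Y (P.map Y) P := ⟨hY, rfl⟩
  have pair := hind.hasLaw_prod hg lawY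
  have strip : MeasurableSet {p : ℝ × β | |p.1| ≤ f p.2} :=
    measurableSet_le (by fun_prop) (by fun_prop)
  have transfer := setIntegral_map (μ := P) (f := fun p : ℝ × β => F p.2) strip
    (mF.comp measurable_snd).aestronglyMeasurable pair.aemeasurable
  rw [pair.map_eq] at transfer
  refine transfer.symm.trans_le ((setIntegral_prod_strip_le mf hf hF
    ((integrable_map_measure (by fun_prop) hY).2 iF)
    ((integrable_map_measure (by fun_prop) hY).2 ifF)).trans_eq ?_)
  exact (lawY.integral_comp (f := fun y => f y * F y) (by fun_prop)).symm

lemma setIntegral_strip_orthPart_le {w w' : ι → ℝ} (hw : w ⬝ᵥ w = 1) (hw' : w' ⬝ᵥ w' = 1)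
    {F : (ι → ℝ) → ℝ} (mF : Measurable F) (hF : ∀ y, 0 ≤ F y)
    (momF : HasAllMoments (fun x => F (orthPart w x)) (gaussianPi ι))
    {K : ℝ} (hK : 0 ≤ K) (hFK : ∫ x, F (orthPart w x) ^ 2 ∂gaussianPi ι ≤ K ^ 2) :
    ∫ x in {x | |x ⬝ᵥ w| ≤ 2 * |orthPart w x ⬝ᵥ w'|}, F (orthPart w x) ∂gaussianPi ι
      ≤ 2 * √((w - w') ⬝ᵥ (w - w')) * K := by
  have width : HasAllMoments (fun x => 2 * |orthPart w x ⬝ᵥ w'|) (gaussianPi ι) :=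
    (HasAllMoments.const 2).mul (hasAllMoments_orthPart_dotProduct w w').abs
  have width_sq : ∫ x, (2 * |orthPart w x ⬝ᵥ w'|) ^ 2 ∂gaussianPi ι
      ≤ 2 ^ 2 * ((w - w') ⬝ᵥ (w - w')) := by
    simp only [mul_pow, sq_abs, orthPart_dotProduct_comm, integral_const_mul,
      integral_dotProduct_sq, orthPart_dotProduct_self hw, hw', sub_dotProduct_sub_self hw hw',
      dotProduct_comm w' w]
    linarith [sq_nonneg (1 - w ⬝ᵥ w')]
  calc ∫ x in {x | |x ⬝ᵥ w| ≤ 2 * |orthPart w x ⬝ᵥ w'|}, F (orthPart w x) ∂gaussianPi ι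
      ≤ ∫ x, 2 * |orthPart w x ⬝ᵥ w'| * F (orthPart w x) ∂gaussianPi ι :=
        setIntegral_strip_le_of_indepFun (f := fun y => 2 * |y ⬝ᵥ w'|)
          (hasLaw_dotProduct_of_unit hw) (measurable_orthPart w).aemeasurable
          (indepFun_dotProduct_orthPart hw) (by fun_prop) mF (fun y => by positivity) hF
          momF.integrable (width.mul momF).integrable
    _ ≤ √(∫ x, (2 * |orthPart w x ⬝ᵥ w'|) ^ 2 ∂gaussianPi ι)
          * √(∫ x, F (orthPart w x) ^ 2 ∂gaussianPi ι) :=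
        integral_mul_le_sqrt_mul_sqrt width.memLp_two momF.memLp_two
    _ ≤ √(2 ^ 2 * ((w - w') ⬝ᵥ (w - w'))) * √(K ^ 2) := by gcongr
    _ = 2 * √((w - w') ⬝ᵥ (w - w')) * K := by
        rw [Real.sqrt_mul (by norm_num), Real.sqrt_sq zero_le_two, Real.sqrt_sq hK]

/-- Two unit vectors close to each other disagree in sign only for `x` in a strip along the
hyperplane orthogonal to `w`, whose width is governed by the independent vector `orthPart w x`. -/
lemma integral_signGap_sq_mul_le {w w' : ι → ℝ} (hw : w ⬝ᵥ w = 1) (hw' : w' ⬝ᵥ w' = 1)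
    {Φ F : (ι → ℝ) → ℝ} (momΦ : HasAllMoments Φ (gaussianPi ι)) (hΦ : ∀ x, 0 ≤ Φ x)
    (mF : Measurable F) (hF : ∀ y, 0 ≤ F y)
    (momF : HasAllMoments (fun x => F (orthPart w x)) (gaussianPi ι))
    (hΦF : ∀ x, |x ⬝ᵥ w| ≤ 2 * |orthPart w x ⬝ᵥ w'| → Φ x ≤ F (orthPart w x))
    {K : ℝ} (hK : 0 ≤ K) (hΦK : ∫ x, Φ x ∂gaussianPi ι ≤ K)
    (hFK : ∫ x, F (orthPart w x) ^ 2 ∂gaussianPi ι ≤ K ^ 2) :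
    ∫ x, signGap w w' x ^ 2 * Φ x ∂gaussianPi ι ≤ 8 * K * √((w - w') ⬝ᵥ (w - w')) := by
  have iΦ := (((hasAllMoments_signGap w w').pow 2).mul momΦ).integrable
  rcases lt_or_ge (w ⬝ᵥ w') (1 / 2) with far | near
  · have one_le : 1 ≤ √((w - w') ⬝ᵥ (w - w')) :=
      Real.one_le_sqrt.2 (by rw [sub_dotProduct_sub_self hw hw']; linarith)
    calc ∫ x, signGap w w' x ^ 2 * Φ x ∂gaussianPi ι ≤ ∫ x, 4 * Φ x ∂gaussianPi ι :=
          integral_mono iΦ (momΦ.integrable.const_mul 4) fun x =>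
            mul_le_mul_of_nonneg_right (signGap_sq_le w w' x) (hΦ x)
      _ ≤ 4 * K := by rw [integral_const_mul]; linarith
      _ ≤ 8 * K * √((w - w') ⬝ᵥ (w - w')) := by nlinarith
  · have strip : MeasurableSet {x | |x ⬝ᵥ w| ≤ 2 * |orthPart w x ⬝ᵥ w'|} :=
      measurableSet_le (by fun_prop) (by have := measurable_orthPart w; fun_prop)
    calc ∫ x, signGap w w' x ^ 2 * Φ x ∂gaussianPi ι
        ≤ ∫ x in {x | |x ⬝ᵥ w| ≤ 2 * |orthPart w x ⬝ᵥ w'|}, 4 * F (orthPart w x)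
            ∂gaussianPi ι := by
          rw [← integral_indicator strip]
          refine integral_mono iΦ ((momF.integrable.const_mul 4).indicator strip) fun x => ?_
          by_cases hx : signGap w w' x = 0
          · simpa [hx] using Set.indicator_nonneg (fun y _ => by linarith [hF (orthPart w y)]) x
          · have mem := abs_dotProduct_le_of_signGap_ne_zero near hx
            rw [Set.indicator_of_mem (by exact mem)]
            exact mul_le_mul (signGap_sq_le w w' x) (hΦF x mem) (hΦ x) zero_le_four
      _ ≤ 4 * (2 * √((w - w') ⬝ᵥ (w - w')) * K) := by
          rw [integral_const_mul]
          gcongr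
          exact setIntegral_strip_orthPart_le hw hw' mF hF momF hK hFK
      _ = 8 * K * √((w - w') ⬝ᵥ (w - w')) := by ring

lemma dotProduct_sq_le_of_mem_strip {w w' x : ι → ℝ}
    (hx : |x ⬝ᵥ w| ≤ 2 * |orthPart w x ⬝ᵥ w'|) :
    (x ⬝ᵥ w) ^ 2 ≤ 4 * (orthPart w x ⬝ᵥ w') ^ 2 := by
  have h := pow_le_pow_left₀ (abs_nonneg _) hx 2
  rw [mul_pow, sq_abs, sq_abs] at h
  linarith

lemma dotProduct_sq_le (u v : ι → ℝ) : (u ⬝ᵥ v) ^ 2 ≤ (u ⬝ᵥ u) * (v ⬝ᵥ v) := by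
  simpa only [dotProduct, sq] using Finset.sum_mul_sq_le_sq_mul_sq Finset.univ u v

lemma integral_signGap_sq_mul_dotProduct_sq_le {w w' : ι → ℝ} (hw : w ⬝ᵥ w = 1)
    (hw' : w' ⬝ᵥ w' = 1) (u : ι → ℝ) :
    ∫ x, signGap w w' x ^ 2 * (x ⬝ᵥ u) ^ 2 ∂gaussianPi ι
      ≤ 168 * √((w - w') ⬝ᵥ (w - w')) * (u ⬝ᵥ u) := by
  have hu := dotProduct_self_nonneg u
  have mom' := (HasAllMoments.const (8 * (w ⬝ᵥ u) ^ 2)).mul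
    ((hasAllMoments_orthPart_dotProduct w w').pow 2)
  have mom := (HasAllMoments.const 2).mul ((hasAllMoments_orthPart_dotProduct w u).pow 2)
  have second_moment : ∫ x, (8 * (w ⬝ᵥ u) ^ 2 * (orthPart w x ⬝ᵥ w') ^ 2
      + 2 * (orthPart w x ⬝ᵥ u) ^ 2) ^ 2 ∂gaussianPi ι ≤ (21 * (u ⬝ᵥ u)) ^ 2 := by
    have hwu : ((w ⬝ᵥ u) ^ 2) ^ 2 ≤ (u ⬝ᵥ u) ^ 2 :=
      pow_le_pow_left₀ (sq_nonneg _) (by simpa [hw] using dotProduct_sq_le w u) 2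
    have four' := integral_orthPart_dotProduct_pow_four_le hw w'
    have four := integral_orthPart_dotProduct_pow_four_le hw u
    rw [hw'] at four'
    refine (integral_add_sq_le mom' mom).trans ?_
    simp only [mul_pow, ← pow_mul, integral_const_mul]
    norm_num at four' hwu ⊢
    nlinarith [mul_le_mul hwu four' (integral_nonneg fun x => by positivity) (by positivity)]
  refine (integral_signGap_sq_mul_le hw hw' ((hasAllMoments_dotProduct u).pow 2)
    (fun x => sq_nonneg _) (F := fun y => 8 * (w ⬝ᵥ u) ^ 2 * (y ⬝ᵥ w') ^ 2 + 2 * (y ⬝ᵥ u) ^ 2)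
    (K := 21 * (u ⬝ᵥ u)) (by fun_prop) (fun y => by positivity) (mom'.add mom) (fun x hx => ?_)
    (by positivity) ?_ second_moment).trans_eq (by ring)
  · have near := mul_le_mul_of_nonneg_left (dotProduct_sq_le_of_mem_strip hx)
      (sq_nonneg (w ⬝ᵥ u))
    have decomposition : x ⬝ᵥ u = orthPart w x ⬝ᵥ u + (x ⬝ᵥ w) * (w ⬝ᵥ u) := by
      rw [orthPart_dotProduct]; ring
    rw [decomposition]
    refine add_sq_le.trans ?_
    rw [mul_pow]
    linarith
  · rw [integral_dotProduct_sq]; linarith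

lemma integral_signGap_sq_mul_normSq_sub_card_sq_le {w w' : ι → ℝ} (hw : w ⬝ᵥ w = 1)
    (hw' : w' ⬝ᵥ w' = 1) :
    ∫ x, signGap w w' x ^ 2 * (x ⬝ᵥ x - Fintype.card ι) ^ 2 ∂gaussianPi ι
      ≤ 3864 * Fintype.card ι * √((w - w') ⬝ᵥ (w - w')) := by
  have one_le_card : (1 : ℝ) ≤ Fintype.card ι := by
    have : Nonempty ι := by
      by_contra h
      rw [not_nonempty_iff] at h
      simp at hw
    exact_mod_cast Fintype.card_pos
  have momN : HasAllMoments (fun x => x ⬝ᵥ x - (Fintype.card ι : ℝ)) (gaussianPi ι) :=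
    hasAllMoments_dotProduct_self.sub (.const _)
  have mom' := (HasAllMoments.const 32).mul ((hasAllMoments_orthPart_dotProduct w w').pow 4)
  have momO : HasAllMoments (fun x => orthPart w x ⬝ᵥ orthPart w x - (Fintype.card ι : ℝ))
      (gaussianPi ι) := by
    simp only [orthPart_dotProduct_self hw]
    exact (hasAllMoments_dotProduct_self.sub ((hasAllMoments_dotProduct w).pow 2)).sub (.const _)
  have mom := (HasAllMoments.const 2).mul (momO.pow 2)
  have second_moment : ∫ x, (32 * (orthPart w x ⬝ᵥ w') ^ 4
      + 2 * (orthPart w x ⬝ᵥ orthPart w x - Fintype.card ι) ^ 2) ^ 2 ∂gaussianPi ι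
      ≤ (483 * (Fintype.card ι : ℝ)) ^ 2 := by
    have eight := integral_orthPart_dotProduct_pow_eight_le hw w'
    have four := integral_normSq_orthPart_sub_card_pow_four_le hw
    rw [hw'] at eight
    refine (integral_add_sq_le mom' mom).trans ?_
    simp only [mul_pow, ← pow_mul, integral_const_mul]
    norm_num at eight ⊢
    nlinarith
  refine (integral_signGap_sq_mul_le hw hw' (momN.pow 2) (fun x => sq_nonneg _)
    (F := fun y => 32 * (y ⬝ᵥ w') ^ 4 + 2 * (y ⬝ᵥ y - Fintype.card ι) ^ 2)
    (K := 483 * Fintype.card ι) (by fun_prop) (fun y => by positivity) (mom'.add mom)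
    (fun x hx => ?_) (by positivity) ?_ second_moment).trans_eq (by ring)
  · have near := pow_le_pow_left₀ (sq_nonneg _) (dotProduct_sq_le_of_mem_strip hx) 2
    have decomposition : x ⬝ᵥ x - Fintype.card ι
        = (x ⬝ᵥ w) ^ 2 + (orthPart w x ⬝ᵥ orthPart w x - Fintype.card ι) := by
      rw [orthPart_dotProduct_self hw]; ring
    rw [decomposition]
    refine add_sq_le.trans ?_
    rw [mul_pow] at near
    linarith
  · linarith [integral_normSq_sub_card_sq_le (ι := ι)]

end Gaussian

section Matrices

open scoped Matrix

variable {m n 𝕜 : Type*} [Fintype m] [Fintype n] [RCLike 𝕜]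

lemma sum_norm_sq_eq_trace_conjTranspose_mul_self (A : Matrix m n 𝕜) :
    ((∑ a, ∑ j, ‖A a j‖ ^ 2 : ℝ) : 𝕜) = (Aᴴ * A).trace := by
  rw [Finset.sum_comm]
  simp [Matrix.trace, Matrix.mul_apply, RCLike.conj_mul]

section Norms

variable [DecidableEq n]

lemma l2_opNorm_sq_le_sum_norm_sq (A : Matrix m n 𝕜) : ‖A‖ ^ 2 ≤ ∑ a, ∑ j, ‖A a j‖ ^ 2 := by
  have nonneg : 0 ≤ ∑ a, ∑ j, ‖A a j‖ ^ 2 := by positivity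
  refine (Real.le_sqrt (norm_nonneg A) nonneg).1 ?_
  rw [Matrix.l2_opNorm_def]
  refine ContinuousLinearMap.opNorm_le_bound _ (Real.sqrt_nonneg _) fun x => ?_
  rw [EuclideanSpace.norm_eq, EuclideanSpace.norm_eq, ← Real.sqrt_mul nonneg, Finset.sum_mul]
  refine Real.sqrt_le_sqrt (Finset.sum_le_sum fun a _ => ?_)
  calc ‖∑ j, A a j * x j‖ ^ 2 ≤ (∑ j, ‖A a j‖ * ‖x j‖) ^ 2 := by
        gcongr
        exact norm_sum_le_of_le _ fun j _ => (norm_mul _ _).le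
    _ ≤ (∑ j, ‖A a j‖ ^ 2) * ∑ j, ‖x j‖ ^ 2 := Finset.sum_mul_sq_le_sq_mul_sq _ _ _

lemma eigenvalues_le_l2_opNorm {A : Matrix n n 𝕜} (hA : A.IsHermitian) (i : n) :
    hA.eigenvalues i ≤ ‖A‖ := by
  have h : ‖hA.eigenvalues i • hA.eigenvectorBasis i‖ ≤ ‖A‖ * ‖hA.eigenvectorBasis i‖ := by
    have := Matrix.l2_opNorm_mulVec A (hA.eigenvectorBasis i)
    rwa [hA.mulVec_eigenvectorBasis] at this
  rw [norm_smul, hA.eigenvectorBasis.norm_eq_one, mul_one, mul_one] at h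
  exact (Real.le_norm_self _).trans h

open scoped ComplexOrder in
lemma sum_norm_sq_le_rank_mul_l2_opNorm_sq (A : Matrix m n 𝕜) :
    ∑ a, ∑ j, ‖A a j‖ ^ 2 ≤ A.rank * ‖A‖ ^ 2 := by
  have hA : (Aᴴ * A).IsHermitian := Matrix.isHermitian_conjTranspose_mul_self A
  have frobenius : ∑ a, ∑ j, ‖A a j‖ ^ 2 = ∑ i, hA.eigenvalues i := by
    have h := sum_norm_sq_eq_trace_conjTranspose_mul_self A
    rw [hA.trace_eq_sum_eigenvalues] at h
    exact_mod_cast h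
  calc ∑ a, ∑ j, ‖A a j‖ ^ 2 = ∑ i with hA.eigenvalues i ≠ 0, hA.eigenvalues i := by
        rw [frobenius, Finset.sum_filter_ne_zero]
    _ ≤ ∑ i with hA.eigenvalues i ≠ 0, ‖A‖ ^ 2 := Finset.sum_le_sum fun i _ => by
        rw [sq, ← Matrix.l2_opNorm_conjTranspose_mul_self]
        exact eigenvalues_le_l2_opNorm hA i
    _ = A.rank * ‖A‖ ^ 2 := by
        rw [Finset.sum_const, nsmul_eq_mul, ← Matrix.rank_conjTranspose_mul_self,
          hA.rank_eq_card_non_zero_eigs, Fintype.card_subtype]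

lemma hasAllMoments_l2_opNorm {Ω : Type*} [MeasurableSpace Ω] {P : Measure Ω} [IsFiniteMeasure P]
    {A : Ω → Matrix m n ℝ} (hA : ∀ a j, HasAllMoments (fun ω => A ω a j) P) :
    HasAllMoments (fun ω => ‖A ω‖) P := fun k => by
  have dominating : HasAllMoments (fun ω => 1 + ∑ a, ∑ j, A ω a j ^ 2) P :=
    (HasAllMoments.const 1).add (.sum fun a _ => .sum fun j _ => (hA a j).pow 2)
  have entries : AEMeasurable (fun ω a j => A ω a j) P :=
    aemeasurable_pi_lambda _ fun a => aemeasurable_pi_lambda _ fun j => (hA a j).aemeasurable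
  have norm_continuous : Continuous fun B : m → n → ℝ => ‖Matrix.of B‖ :=
    continuous_norm (E := Matrix m n ℝ)
  refine (dominating k).mono
    (norm_continuous.measurable.comp_aemeasurable entries).aestronglyMeasurable
    (.of_forall fun ω => ?_)
  have h := l2_opNorm_sq_le_sum_norm_sq (A ω)
  simp only [Real.norm_eq_abs, sq_abs] at h
  rw [norm_norm]
  refine le_trans ?_ (Real.le_norm_self _)
  nlinarith [sq_nonneg (‖A ω‖ - 1)]

end Norms

section Gram

lemma conjTranspose_sum_mul_sum {ι m n 𝕜 : Type*} [Fintype ι] [Fintype m] [NonUnitalSemiring 𝕜]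
    [StarRing 𝕜] (C : ι → Matrix m n 𝕜) :
    (∑ i, C i)ᴴ * ∑ i, C i
      = ∑ i, (C i)ᴴ * C i + ∑ p ∈ Finset.univ.offDiag, (C p.1)ᴴ * C p.2 := by
  classical
  rw [Matrix.conjTranspose_sum, Matrix.sum_mul]
  simp only [Matrix.mul_sum]
  rw [← Finset.sum_product' (f := fun i i' => (C i)ᴴ * C i'), ← Finset.diag_union_offDiag,
    Finset.sum_union (Finset.disjoint_diag_offDiag _), Finset.sum_diag]

lemma sum_conjTranspose_sub_mul_sub {ι m n 𝕜 : Type*} [Fintype ι] [Fintype m] [NonUnitalRing 𝕜]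
    [StarRing 𝕜] (B : ι → Matrix m n 𝕜) (β : Matrix m n 𝕜) :
    ∑ i, (B i - β)ᴴ * (B i - β)
      = ∑ i, (B i)ᴴ * B i - (∑ i, (B i - β))ᴴ * β - βᴴ * ∑ i, (B i - β)
        - Fintype.card ι • (βᴴ * β) := by
  simp only [Matrix.conjTranspose_sum, Matrix.sum_mul, Matrix.mul_sum, Matrix.conjTranspose_sub,
    Matrix.sub_mul, Matrix.mul_sub, Finset.sum_sub_distrib, Finset.sum_const, Finset.card_univ,
    Matrix.conjTranspose_nsmul, Matrix.smul_mul, Matrix.mul_smul]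
  abel

variable {ι : Type*} [Fintype ι]

lemma l2_opNorm_sum_sub_sq_le [DecidableEq n] (B : ι → Matrix m n 𝕜) (β : Matrix m n 𝕜) :
    ‖∑ i, (B i - β)‖ ^ 2 ≤ 2 * ‖∑ i, (B i)ᴴ * B i‖
      + 2 * ‖∑ p ∈ Finset.univ.offDiag, (B p.1 - β)ᴴ * (B p.2 - β)‖
      + 6 * Fintype.card ι * ‖β‖ ^ 2 := by
  classical
  rcases isEmpty_or_nonempty ι with _ | _
  · simp
  have one_le_card : (1 : ℝ) ≤ Fintype.card ι := mod_cast Fintype.card_pos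
  set A := ∑ i, (B i - β) with hA
  set D := ∑ i, (B i)ᴴ * B i
  set H := ∑ p ∈ Finset.univ.offDiag, (B p.1 - β)ᴴ * (B p.2 - β)
  have gram : Aᴴ * A = D + H - Aᴴ * β - βᴴ * A - Fintype.card ι • (βᴴ * β) := by
    rw [hA, conjTranspose_sum_mul_sum, sum_conjTranspose_sub_mul_sub]
    abel
  have norm_mul (X Y : Matrix m n 𝕜) : ‖Xᴴ * Y‖ ≤ ‖X‖ * ‖Y‖ := by
    simpa only [Matrix.l2_opNorm_conjTranspose] using Matrix.l2_opNorm_mul Xᴴ Y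
  have gram_norm :
      ‖A‖ * ‖A‖ ≤ ‖D‖ + ‖H‖ + ‖A‖ * ‖β‖ + ‖β‖ * ‖A‖ + Fintype.card ι * (‖β‖ * ‖β‖) := by
    rw [← Matrix.l2_opNorm_conjTranspose_mul_self, gram]
    refine norm_sub_le_of_le (norm_sub_le_of_le (norm_sub_le_of_le (norm_add_le _ _)
      (norm_mul _ _)) (norm_mul _ _)) (norm_nsmul_le.trans ?_)
    rw [Matrix.l2_opNorm_conjTranspose_mul_self]
  nlinarith [sq_nonneg (‖A‖ - 2 * ‖β‖), sq_nonneg ‖β‖]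

lemma sum_conjTranspose_mul_vecMulVec_single {ι m n : Type*} [Fintype ι] [Fintype m]
    [DecidableEq n] (u : ι → m → ℝ) (c : ι → n) :
    ∑ i, (Matrix.vecMulVec (u i) (Pi.single (c i) 1))ᴴ
        * Matrix.vecMulVec (u i) (Pi.single (c i) 1)
      = Matrix.diagonal fun j => ∑ i, if c i = j then u i ⬝ᵥ u i else 0 := by
  have term (i : ι) : (Matrix.vecMulVec (u i) (Pi.single (c i) 1))ᴴ
      * Matrix.vecMulVec (u i) (Pi.single (c i) 1)
      = Matrix.diagonal fun j => if c i = j then u i ⬝ᵥ u i else 0 := by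
    rw [Matrix.conjTranspose_vecMulVec, Matrix.vecMulVec_mul_vecMulVec]
    ext j l
    simp only [Matrix.vecMulVec_apply, star_trivial, Pi.smul_apply, smul_eq_mul,
      Matrix.diagonal_apply, Pi.single_apply]
    grind
  simp only [term]
  ext j l
  rw [Matrix.sum_apply]
  by_cases h : j = l <;> simp [h]

lemma sq_sum_le_add_sum_offDiag {ι : Type*} (s : Finset ι) {t : ι → ℝ} {M : ℝ}
    (ht : ∀ i ∈ s, 0 ≤ t i) (hM : ∀ i ∈ s, t i ^ 2 ≤ M) (hM₀ : 0 ≤ M) :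
    (∑ i ∈ s, t i) ^ 2 ≤ M + 2 * ∑ p ∈ s.offDiag, t p.1 * t p.2 := by
  classical
  have split : (∑ i ∈ s, t i) ^ 2 = ∑ i ∈ s, t i ^ 2 + ∑ p ∈ s.offDiag, t p.1 * t p.2 := by
    rw [sq, Finset.sum_mul_sum, ← Finset.sum_product', ← Finset.diag_union_offDiag,
      Finset.sum_union (Finset.disjoint_diag_offDiag _), Finset.sum_diag]
    simp only [sq]
  have diag : ∑ i ∈ s, t i ^ 2 ≤ √M * ∑ i ∈ s, t i := by
    rw [Finset.mul_sum]
    refine Finset.sum_le_sum fun i hi => ?_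
    rw [sq]
    exact mul_le_mul_of_nonneg_right (Real.le_sqrt_of_sq_le (hM i hi)) (ht i hi)
  nlinarith [sq_nonneg (√M - ∑ i ∈ s, t i), Real.sq_sqrt hM₀]

lemma l2_opNorm_diagonal_sum_sq_le [DecidableEq n] {g : ι → n → ℝ} {M : ℝ}
    (hg : ∀ i j, 0 ≤ g i j) (hM : ∀ i j, g i j ^ 2 ≤ M) (hM₀ : 0 ≤ M) :
    ‖Matrix.diagonal fun j => ∑ i, g i j‖ ^ 2
      ≤ M + 2 * ∑ j, ∑ p ∈ Finset.univ.offDiag, g p.1 j * g p.2 j := by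
  have hpairs (j : n) : 0 ≤ ∑ p ∈ Finset.univ.offDiag, g p.1 j * g p.2 j :=
    Finset.sum_nonneg fun p _ => mul_nonneg (hg _ j) (hg _ j)
  have hbound := add_nonneg hM₀ (mul_nonneg zero_le_two
    (Finset.univ.sum_nonneg fun j _ => hpairs j))
  rw [Matrix.l2_opNorm_diagonal]
  refine (Real.le_sqrt (norm_nonneg _) hbound).1
    ((pi_norm_le_iff_of_nonneg (Real.sqrt_nonneg _)).2 fun j => Real.le_sqrt_of_sq_le ?_)
  rw [Real.norm_eq_abs, sq_abs]
  refine (sq_sum_le_add_sum_offDiag Finset.univ (fun i _ => hg i j) (fun i _ => hM i j)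
    hM₀).trans ?_
  gcongr
  exact Finset.single_le_sum (fun j _ => hpairs j) (Finset.mem_univ j)

end Gram

end Matrices

section UStatistic

variable {ι Ω S : Type*} [MeasurableSpace Ω] [MeasurableSpace S] {P : Measure Ω}
  [IsProbabilityMeasure P] {μ : Measure S}

lemma integral_comp_eq_zero_of_indepFun [SFinite μ] {T : Type*} [MeasurableSpace T] {X : Ω → S}
    {Y : Ω → T} (hX : HasLaw X μ P) (hY : AEMeasurable Y P) (hXY : IndepFun X Y P) {Φ : S × T → ℝ}
    (hΦ : Measurable Φ) (integrable : Integrable (fun ω => Φ (X ω, Y ω)) P)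
    (centred : ∀ y, ∫ x, Φ (x, y) ∂μ = 0) : ∫ ω, Φ (X ω, Y ω) ∂P = 0 := by
  have : IsProbabilityMeasure (P.map Y) := Measure.isProbabilityMeasure_map hY
  have joint : HasLaw (fun ω => (X ω, Y ω)) (μ.prod (P.map Y)) P := hXY.hasLaw_prod hX ⟨hY, rfl⟩
  have integrable_joint : Integrable Φ (μ.prod (P.map Y)) := by
    rw [← joint.map_eq]
    exact (integrable_map_measure hΦ.aestronglyMeasurable joint.aemeasurable).2 integrable
  calc ∫ ω, Φ (X ω, Y ω) ∂P = ∫ p, Φ p ∂μ.prod (P.map Y) :=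
        joint.integral_comp hΦ.aestronglyMeasurable
    _ = ∫ y, ∫ x, Φ (x, y) ∂μ ∂P.map Y := integral_prod_symm _ integrable_joint
    _ = 0 := by simp only [centred, integral_zero]

/-- A completely degenerate square integrable kernel of order two: it integrates to zero in each
of its arguments. Two terms of its `U`-statistic are orthogonal unless they involve the same two
sample points. -/
structure IsDegenerateKernel (h : S × S → ℝ) (μ : Measure S) : Prop where
  measurable : Measurable h
  memLp_two : MemLp h 2 (μ.prod μ)
  integral_fst : ∀ t, ∫ s, h (s, t) ∂μ = 0
  integral_snd : ∀ s, ∫ t, h (s, t) ∂μ = 0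

variable {h k : S × S → ℝ} {ξ : ι → Ω → S}

namespace IsDegenerateKernel

lemma memLp_two_comp (hh : IsDegenerateKernel h μ) (hlaw : ∀ i, HasLaw (ξ i) μ P)
    (hind : iIndepFun ξ P) {p : ι × ι} (hp : p.1 ≠ p.2) :
    MemLp (fun ω => h (ξ p.1 ω, ξ p.2 ω)) 2 P := by
  have joint := (hind.indepFun hp).hasLaw_prod (hlaw p.1) (hlaw p.2)
  have h_memLp := hh.memLp_two
  rw [← joint.map_eq] at h_memLp
  exact h_memLp.comp_of_map joint.aemeasurable

lemma integral_sq_comp (hh : IsDegenerateKernel h μ) (hlaw : ∀ i, HasLaw (ξ i) μ P)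
    (hind : iIndepFun ξ P) {p : ι × ι} (hp : p.1 ≠ p.2) :
    ∫ ω, h (ξ p.1 ω, ξ p.2 ω) ^ 2 ∂P = ∫ s, h s ^ 2 ∂μ.prod μ :=
  ((hind.indepFun hp).hasLaw_prod (hlaw p.1) (hlaw p.2)).integral_comp (f := fun s => h s ^ 2)
    (hh.measurable.pow_const 2).aestronglyMeasurable

variable [IsProbabilityMeasure μ]

lemma swap (hh : IsDegenerateKernel h μ) : IsDegenerateKernel (fun p => h p.swap) μ where
  measurable := hh.measurable.comp measurable_swap
  memLp_two := hh.memLp_two.comp_measurePreserving Measure.measurePreserving_swap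
  integral_fst := hh.integral_snd
  integral_snd := hh.integral_fst

lemma integral_mul_comp_of_fst_ne (hh : IsDegenerateKernel h μ) (hk : IsDegenerateKernel k μ)
    (hlaw : ∀ i, HasLaw (ξ i) μ P) (hind : iIndepFun ξ P) {p q : ι × ι} (hp : p.1 ≠ p.2)
    (hq : q.1 ≠ q.2) (h₁ : p.1 ≠ q.1) (h₂ : p.1 ≠ q.2) :
    ∫ ω, h (ξ p.1 ω, ξ p.2 ω) * k (ξ q.1 ω, ξ q.2 ω) ∂P = 0 := by
  classical
  have indep := hind.indepFun_finset₀ {p.1} {p.2, q.1, q.2} (by simp [hp, h₁, h₂])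
    fun i => (hlaw i).aemeasurable
  exact integral_comp_eq_zero_of_indepFun
    (Y := fun ω (i : ({p.2, q.1, q.2} : Finset ι)) => ξ i ω)
    (Φ := fun r => h (r.1, r.2 ⟨p.2, by simp⟩) * k (r.2 ⟨q.1, by simp⟩, r.2 ⟨q.2, by simp⟩))
    (hlaw p.1) (aemeasurable_pi_lambda _ fun i => (hlaw i).aemeasurable)
    (indep.comp
      (measurable_pi_apply (⟨p.1, Finset.mem_singleton_self _⟩ : ({p.1} : Finset ι))) measurable_id)
    ((hh.measurable.comp (by fun_prop)).mul (hk.measurable.comp (by fun_prop)))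
    ((hh.memLp_two_comp hlaw hind hp).integrable_mul (hk.memLp_two_comp hlaw hind hq))
    fun y => by simp only [integral_mul_const, hh.integral_fst, zero_mul]

lemma integral_mul_comp_eq_zero (hh : IsDegenerateKernel h μ) (hlaw : ∀ i, HasLaw (ξ i) μ P)
    (hind : iIndepFun ξ P) {p q : ι × ι} (hp : p.1 ≠ p.2) (hq : q.1 ≠ q.2) (hqp : q ≠ p)
    (hqp' : q ≠ p.swap) : ∫ ω, h (ξ p.1 ω, ξ p.2 ω) * h (ξ q.1 ω, ξ q.2 ω) ∂P = 0 := by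
  by_cases h_fst : p.1 ≠ q.1 ∧ p.1 ≠ q.2
  · exact hh.integral_mul_comp_of_fst_ne hh hlaw hind hp hq h_fst.1 h_fst.2
  · have h_snd : p.2 ≠ q.1 ∧ p.2 ≠ q.2 := by grind [Prod.swap, Prod.ext_iff]
    exact hh.swap.integral_mul_comp_of_fst_ne (p := p.swap) hh hlaw hind hp.symm hq h_snd.1 h_snd.2

variable [Fintype ι]

lemma sum_integral_mul_comp_le (hh : IsDegenerateKernel h μ) (hlaw : ∀ i, HasLaw (ξ i) μ P)
    (hind : iIndepFun ξ P) {p : ι × ι} (hp : p.1 ≠ p.2) :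
    ∑ q ∈ Finset.univ.offDiag, ∫ ω, h (ξ p.1 ω, ξ p.2 ω) * h (ξ q.1 ω, ξ q.2 ω) ∂P
      ≤ 2 * ∫ s, h s ^ 2 ∂μ.prod μ := by
  classical
  have nonneg : 0 ≤ ∫ s, h s ^ 2 ∂μ.prod μ := integral_nonneg fun s => sq_nonneg _
  have le (q : ι × ι) (hq : q.1 ≠ q.2) :
      ∫ ω, h (ξ p.1 ω, ξ p.2 ω) * h (ξ q.1 ω, ξ q.2 ω) ∂P ≤ ∫ s, h s ^ 2 ∂μ.prod μ := by
    refine (integral_mul_le_sqrt_mul_sqrt (hh.memLp_two_comp hlaw hind hp)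
      (hh.memLp_two_comp hlaw hind hq)).trans_eq ?_
    rw [hh.integral_sq_comp hlaw hind hp, hh.integral_sq_comp hlaw hind hq,
      Real.mul_self_sqrt nonneg]
  calc _ ≤ ∑ q ∈ Finset.univ.offDiag with q ∈ ({p, p.swap} : Finset (ι × ι)),
        ∫ s, h s ^ 2 ∂μ.prod μ := by
        rw [Finset.sum_filter]
        refine Finset.sum_le_sum fun q hq => ?_
        have hq : q.1 ≠ q.2 := by simpa using hq
        split_ifs with shared
        · exact le q hq
        · simp only [Finset.mem_insert, Finset.mem_singleton, not_or] at shared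
          exact (hh.integral_mul_comp_eq_zero hlaw hind hp hq shared.1 shared.2).le
    _ ≤ ∑ q ∈ ({p, p.swap} : Finset (ι × ι)), ∫ s, h s ^ 2 ∂μ.prod μ :=
        Finset.sum_le_sum_of_subset_of_nonneg (fun q hq => (Finset.mem_filter.1 hq).2)
          fun _ _ _ => nonneg
    _ ≤ 2 * ∫ s, h s ^ 2 ∂μ.prod μ := by
        rw [Finset.sum_const, nsmul_eq_mul]
        gcongr
        exact_mod_cast Finset.card_le_two

theorem integral_sum_offDiag_sq_le (hh : IsDegenerateKernel h μ) (hlaw : ∀ i, HasLaw (ξ i) μ P)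
    (hind : iIndepFun ξ P) :
    ∫ ω, (∑ p ∈ Finset.univ.offDiag, h (ξ p.1 ω, ξ p.2 ω)) ^ 2 ∂P
      ≤ 2 * (Fintype.card ι : ℝ) ^ 2 * ∫ s, h s ^ 2 ∂μ.prod μ := by
  have memLp {p : ι × ι} (hp : p ∈ Finset.univ.offDiag) :
      MemLp (fun ω => h (ξ p.1 ω, ξ p.2 ω)) 2 P :=
    hh.memLp_two_comp hlaw hind (Finset.mem_offDiag.1 hp).2.2
  have integrable {p q : ι × ι} (hp : p ∈ Finset.univ.offDiag) (hq : q ∈ Finset.univ.offDiag) :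
      Integrable (fun ω => h (ξ p.1 ω, ξ p.2 ω) * h (ξ q.1 ω, ξ q.2 ω)) P :=
    (memLp hp).integrable_mul (memLp hq)
  have card_le : ((Finset.univ.offDiag : Finset (ι × ι)).card : ℝ) ≤ Fintype.card ι ^ 2 := by
    rw [Finset.offDiag_card, ← Finset.card_univ, sq]
    exact_mod_cast Nat.sub_le _ _
  simp only [sq (Finset.sum _ _), Finset.sum_mul_sum]
  rw [integral_finsetSum _ fun _ hp => integrable_finsetSum _ fun _ hq =>
    integrable hp hq]
  calc _ ≤ ∑ p ∈ (Finset.univ.offDiag : Finset (ι × ι)), 2 * ∫ s, h s ^ 2 ∂μ.prod μ := by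
        refine Finset.sum_le_sum fun _ hp => ?_
        rw [integral_finsetSum _ fun _ hq => integrable hp hq]
        exact hh.sum_integral_mul_comp_le hlaw hind (Finset.mem_offDiag.1 hp).2.2
    _ ≤ Fintype.card ι ^ 2 * (2 * ∫ s, h s ^ 2 ∂μ.prod μ) := by
        rw [Finset.sum_const, nsmul_eq_mul]
        gcongr
    _ = 2 * (Fintype.card ι : ℝ) ^ 2 * ∫ s, h s ^ 2 ∂μ.prod μ := by ring

end IsDegenerateKernel

section Gram

variable [IsProbabilityMeasure μ] {m n : Type*} [Fintype m] {M : S → Matrix m n ℝ}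

open scoped Matrix

lemma isDegenerateKernel_conjTranspose_mul (measurable : ∀ a j, Measurable fun s => M s a j)
    (moments : ∀ a j, HasAllMoments (fun s => M s a j) μ)
    (centred : ∀ a j, ∫ s, M s a j ∂μ = 0) (j l : n) :
    IsDegenerateKernel (fun p => ((M p.1)ᴴ * M p.2) j l) μ := by
  simp only [Matrix.mul_apply, Matrix.conjTranspose_apply, star_trivial]
  refine ⟨Finset.measurable_fun_sum _ fun a _ => ((measurable a j).comp measurable_fst).mul
    ((measurable a l).comp measurable_snd), memLp_finsetSum _ fun a _ => ?_, fun t => ?_,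
    fun s => ?_⟩
  · exact (((moments a j).comp_hasLaw measurePreserving_fst.hasLaw).mul
      ((moments a l).comp_hasLaw measurePreserving_snd.hasLaw)).memLp_two
  · dsimp only
    rw [integral_finsetSum _ fun a _ => (moments a j).integrable.mul_const _]
    simp only [integral_mul_const, centred, zero_mul, Finset.sum_const_zero]
  · dsimp only
    rw [integral_finsetSum _ fun a _ => (moments a l).integrable.const_mul _]
    simp only [integral_const_mul, centred, mul_zero, Finset.sum_const_zero]

lemma integral_conjTranspose_mul_sq (moments : ∀ a j, HasAllMoments (fun s => M s a j) μ)
    (j l : n) :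
    ∫ p : S × S, ((M p.1)ᴴ * M p.2) j l ^ 2 ∂μ.prod μ
      = ∑ a, ∑ b, (∫ s, M s a j * M s b j ∂μ) * ∫ s, M s a l * M s b l ∂μ := by
  have expand (p : S × S) : ((M p.1)ᴴ * M p.2) j l ^ 2
      = ∑ a, ∑ b, (M p.1 a j * M p.1 b j) * (M p.2 a l * M p.2 b l) := by
    simp only [Matrix.mul_apply, Matrix.conjTranspose_apply, star_trivial, sq, Finset.sum_mul_sum]
    exact Finset.sum_congr rfl fun a _ => Finset.sum_congr rfl fun b _ => mul_mul_mul_comm _ _ _ _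
  have integrable (a b : m) : Integrable
      (fun p : S × S => (M p.1 a j * M p.1 b j) * (M p.2 a l * M p.2 b l)) (μ.prod μ) :=
    ((moments a j).mul (moments b j)).integrable.mul_prod
      ((moments a l).mul (moments b l)).integrable
  simp only [expand]
  rw [integral_finsetSum _ fun a _ => integrable_finsetSum _ fun b _ => integrable a b]
  refine Finset.sum_congr rfl fun a _ => ?_
  rw [integral_finsetSum _ fun b _ => integrable a b]
  exact Finset.sum_congr rfl fun b _ =>
    integral_prod_mul (fun s => M s a j * M s b j) fun s => M s a l * M s b l

variable [Fintype ι] [Fintype n] [DecidableEq n]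

theorem integral_l2_opNorm_offDiag_gram_sq_le (hlaw : ∀ i, HasLaw (ξ i) μ P)
    (hind : iIndepFun ξ P) (measurable : ∀ a j, Measurable fun s => M s a j)
    (moments : ∀ a j, HasAllMoments (fun s => M s a j) μ)
    (centred : ∀ a j, ∫ s, M s a j ∂μ = 0) :
    ∫ ω, ‖∑ p ∈ Finset.univ.offDiag, (M (ξ p.1 ω))ᴴ * M (ξ p.2 ω)‖ ^ 2 ∂P
      ≤ 2 * (Fintype.card ι : ℝ) ^ 2 * ∑ a, ∑ b, (∑ j, ∫ s, M s a j * M s b j ∂μ) ^ 2 := by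
  set H := fun ω => ∑ p ∈ Finset.univ.offDiag, (M (ξ p.1 ω))ᴴ * M (ξ p.2 ω)
  have H_moments (j l : n) : HasAllMoments (fun ω => H ω j l) P := by
    simp only [H, Matrix.sum_apply, Matrix.mul_apply, Matrix.conjTranspose_apply, star_trivial]
    exact .sum fun p _ => .sum fun a _ =>
      ((moments a j).comp_hasLaw (hlaw _)).mul ((moments a l).comp_hasLaw (hlaw _))
  have entry (j l : n) : ∫ ω, H ω j l ^ 2 ∂P ≤ 2 * (Fintype.card ι : ℝ) ^ 2
      * ∑ a, ∑ b, (∫ s, M s a j * M s b j ∂μ) * ∫ s, M s a l * M s b l ∂μ := by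
    rw [← integral_conjTranspose_mul_sq moments]
    simp only [H, Matrix.sum_apply]
    exact (isDegenerateKernel_conjTranspose_mul measurable moments centred j l
      ).integral_sum_offDiag_sq_le hlaw hind
  calc ∫ ω, ‖H ω‖ ^ 2 ∂P ≤ ∫ ω, ∑ j, ∑ l, H ω j l ^ 2 ∂P := by
        refine integral_mono ((hasAllMoments_l2_opNorm H_moments).pow 2).integrable
          (HasAllMoments.sum fun j _ => .sum fun l _ => (H_moments j l).pow 2).integrable
          fun ω => ?_
        simpa only [Real.norm_eq_abs, sq_abs] using l2_opNorm_sq_le_sum_norm_sq (H ω)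
    _ = ∑ j, ∑ l, ∫ ω, H ω j l ^ 2 ∂P := by
        rw [integral_finsetSum _ fun j _ =>
          (HasAllMoments.sum fun l _ => (H_moments j l).pow 2).integrable]
        exact Finset.sum_congr rfl fun j _ =>
          integral_finsetSum _ fun l _ => ((H_moments j l).pow 2).integrable
    _ ≤ ∑ j, ∑ l, 2 * (Fintype.card ι : ℝ) ^ 2
          * ∑ a, ∑ b, (∫ s, M s a j * M s b j ∂μ) * ∫ s, M s a l * M s b l ∂μ :=
        Finset.sum_le_sum fun j _ => Finset.sum_le_sum fun l _ => entry j l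
    _ = 2 * (Fintype.card ι : ℝ) ^ 2 * ∑ a, ∑ b, (∑ j, ∫ s, M s a j * M s b j ∂μ) ^ 2 := by
        simp only [← Finset.mul_sum (a := 2 * (Fintype.card ι : ℝ) ^ 2), sq (Finset.sum _ _),
          Finset.sum_mul_sum]
        congr 1
        rw [Finset.sum_congr rfl fun _ _ => Finset.sum_comm, Finset.sum_comm]
        refine Finset.sum_congr rfl fun a _ => ?_
        rw [Finset.sum_congr rfl fun _ _ => Finset.sum_comm, Finset.sum_comm]

end Gram

end UStatistic


section Model

variable {ι κ : Type*} [Fintype ι] [MeasurableSpace κ]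

variable (ι κ) in
/-- The law of one pair `(x_i, j_i)`: a standard Gaussian vector indexed by `ι` and an independent
uniformly distributed column index in `κ`. -/
noncomputable abbrev pairLaw : Measure ((ι → ℝ) × κ) := (gaussianPi ι).prod (uniformOn Set.univ)

section PairLaw

variable [MeasurableSingletonClass κ]

instance isProbabilityMeasure_uniformOn_univ [Finite κ] [Nonempty κ] :
    IsProbabilityMeasure (uniformOn (Set.univ : Set κ)) :=
  isProbabilityMeasure_uniformOn Set.finite_univ Set.univ_nonempty

lemma integral_ite_eq_uniformOn_univ [Fintype κ] [DecidableEq κ] (c : κ) :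
    ∫ c', (if c' = c then (1 : ℝ) else 0) ∂uniformOn Set.univ = (Fintype.card κ : ℝ)⁻¹ := by
  have indicator : (fun c' => if c' = c then (1 : ℝ) else 0) = Set.indicator {c} 1 := by
    ext c'
    simp [Set.indicator]
  rw [indicator, integral_indicator_one (measurableSet_singleton c), measureReal_def,
    uniformOn_univ]
  simp

variable {f : (ι → ℝ) × κ → ℝ}

lemma hasAllMoments_pairLaw [Finite κ] [Nonempty κ]
    (hf : ∀ c, HasAllMoments (fun x => f (x, c)) (gaussianPi ι)) :
    HasAllMoments f (pairLaw ι κ) := by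
  classical
  have := Fintype.ofFinite κ
  have split : f = fun p => ∑ c, f (p.1, c) * if p.2 = c then 1 else 0 := by
    ext p
    simp
  rw [split]
  refine .sum fun c _ => ((hf c).comp_hasLaw measurePreserving_fst.hasLaw).mul
    (.of_bound ?_ 1 fun p => by split_ifs <;> simp)
  exact (Measurable.ite (measurable_snd (measurableSet_singleton c)) measurable_const
    measurable_const).aestronglyMeasurable

variable [Fintype κ]

lemma integral_pairLaw (hf : ∀ c, HasAllMoments (fun x => f (x, c)) (gaussianPi ι)) :
    ∫ p, f p ∂pairLaw ι κ = (∑ c, ∫ x, f (x, c) ∂gaussianPi ι) / Fintype.card κ := by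
  classical
  have integrable (c : κ) : Integrable (fun p : (ι → ℝ) × κ =>
      f (p.1, c) * if p.2 = c then (1 : ℝ) else 0) (pairLaw ι κ) :=
    (hf c).integrable.mul_prod (g := fun c' => if c' = c then (1 : ℝ) else 0) .of_finite
  calc ∫ p, f p ∂pairLaw ι κ
      = ∫ p, ∑ c, f (p.1, c) * (if p.2 = c then 1 else 0) ∂pairLaw ι κ := by simp
    _ = ∑ c, (∫ x, f (x, c) ∂gaussianPi ι) * (Fintype.card κ : ℝ)⁻¹ := by
        rw [integral_finsetSum _ fun c _ => integrable c]
        refine Finset.sum_congr rfl fun c _ => ?_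
        rw [← integral_ite_eq_uniformOn_univ c]
        exact integral_prod_mul (fun x => f (x, c)) fun c' => if c' = c then (1 : ℝ) else 0
    _ = (∑ c, ∫ x, f (x, c) ∂gaussianPi ι) / Fintype.card κ := by
        rw [← Finset.sum_mul, div_eq_mul_inv]

lemma integral_pairLaw_of_ne {j : κ}
    (hf : HasAllMoments (fun x => f (x, j)) (gaussianPi ι)) (hj : ∀ x c, c ≠ j → f (x, c) = 0) :
    ∫ p, f p ∂pairLaw ι κ = (∫ x, f (x, j) ∂gaussianPi ι) / Fintype.card κ := by
  classical
  have moments (c : κ) : HasAllMoments (fun x => f (x, c)) (gaussianPi ι) := by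
    obtain rfl | hc := eq_or_ne c j
    · exact hf
    · simpa only [hj _ c hc] using HasAllMoments.const 0
  rw [integral_pairLaw moments, Finset.sum_eq_single j (fun c _ hc => by simp [hj _ c hc])
    (by simp)]

end PairLaw

section ColDist

variable {ι κ : Type*} [Fintype ι] (W W' : Matrix ι κ ℝ)

/-- The Euclidean distance of two corresponding columns. -/
noncomputable def colDist (c : κ) : ℝ := √((W.col c - W'.col c) ⬝ᵥ (W.col c - W'.col c))

lemma colDist_nonneg (c : κ) : 0 ≤ colDist W W' c := Real.sqrt_nonneg _

lemma colDist_sq (c : κ) : colDist W W' c ^ 2 = ∑ a, (W - W') a c ^ 2 := by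
  rw [colDist, Real.sq_sqrt (dotProduct_self_nonneg _)]
  simp [dotProduct, Matrix.col, sq]

lemma sum_colDist_sq [Fintype κ] : ∑ c, colDist W W' c ^ 2 = ∑ a, ∑ c, (W - W') a c ^ 2 := by
  simp only [colDist_sq]
  exact Finset.sum_comm

variable {W W'}

lemma colDist_sq_le {c : κ} (hW : W.col c ⬝ᵥ W.col c = 1) (hW' : W'.col c ⬝ᵥ W'.col c = 1) :
    colDist W W' c ^ 2 ≤ 4 := by
  have nonneg := dotProduct_self_nonneg (W.col c + W'.col c)
  rw [colDist, Real.sq_sqrt (dotProduct_self_nonneg _)]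
  simp only [sub_dotProduct, dotProduct_sub, add_dotProduct, dotProduct_add, hW, hW'] at nonneg ⊢
  linarith

end ColDist

section SecondMoment

variable {α : Type*} [MeasurableSpace α] {μ : Measure α}

lemma integral_sub_mul_sub [IsProbabilityMeasure μ] {f g : α → ℝ} (hf : HasAllMoments f μ)
    (hg : HasAllMoments g μ) :
    ∫ p, (f p - ∫ q, f q ∂μ) * (g p - ∫ q, g q ∂μ) ∂μ
      = ∫ p, f p * g p ∂μ - (∫ p, f p ∂μ) * ∫ p, g p ∂μ :=
  covariance_eq_sub hf.memLp_two hg.memLp_two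

variable [IsFiniteMeasure μ] {v : ι → α → ℝ} {τ : ℝ}

lemma sum_sq_integral_mul_le (hv : ∀ a, HasAllMoments (v a) μ) (hτ : 0 ≤ τ)
    (h : ∀ u : ι → ℝ, ∫ s, (∑ a, v a s * u a) ^ 2 ∂μ ≤ τ * (u ⬝ᵥ u)) (a : ι) :
    ∑ b, (∫ s, v a s * v b s ∂μ) ^ 2 ≤ τ ^ 2 := by
  classical
  set g : ι → ℝ := fun b => ∫ s, v a s * v b s ∂μ
  have g_nonneg := dotProduct_self_nonneg g
  have moments : HasAllMoments (fun s => ∑ b, v b s * g b) μ :=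
    .sum fun b _ => (hv b).mul (.const (g b))
  have expand : g ⬝ᵥ g = ∫ s, v a s * ∑ b, v b s * g b ∂μ := by
    simp only [Finset.mul_sum, ← mul_assoc]
    rw [integral_finsetSum _ fun b _ => (((hv a).mul (hv b)).mul (.const (g b))).integrable]
    simp only [integral_mul_const]
    rfl
  have diag : ∫ s, v a s ^ 2 ∂μ ≤ τ := by
    simpa [Pi.single_apply] using h (Pi.single a 1)
  have bound : g ⬝ᵥ g ≤ τ * √(g ⬝ᵥ g) :=
    calc g ⬝ᵥ g ≤ √(∫ s, v a s ^ 2 ∂μ) * √(∫ s, (∑ b, v b s * g b) ^ 2 ∂μ) :=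
          expand.trans_le (integral_mul_le_sqrt_mul_sqrt (hv a).memLp_two moments.memLp_two)
      _ ≤ √τ * √(τ * (g ⬝ᵥ g)) := by gcongr; exact h g
      _ = τ * √(g ⬝ᵥ g) := by rw [Real.sqrt_mul hτ, ← mul_assoc, Real.mul_self_sqrt hτ]
  calc ∑ b, (∫ s, v a s * v b s ∂μ) ^ 2 = g ⬝ᵥ g := by simp only [dotProduct, sq, g]
    _ ≤ τ ^ 2 := by nlinarith [sq_nonneg (√(g ⬝ᵥ g) - τ), Real.sq_sqrt g_nonneg]

lemma sum_sum_sq_integral_mul_le (hv : ∀ a, HasAllMoments (v a) μ) (hτ : 0 ≤ τ)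
    (h : ∀ u : ι → ℝ, ∫ s, (∑ a, v a s * u a) ^ 2 ∂μ ≤ τ * (u ⬝ᵥ u)) :
    ∑ a, ∑ b, (∫ s, v a s * v b s ∂μ) ^ 2 ≤ Fintype.card ι * τ ^ 2 := by
  calc _ ≤ ∑ _a : ι, τ ^ 2 := Finset.sum_le_sum fun a _ => sum_sq_integral_mul_le hv hτ h a
    _ = Fintype.card ι * τ ^ 2 := by rw [Finset.sum_const, nsmul_eq_mul, Finset.card_univ]

end SecondMoment

section GapMatrix

variable {W W' : Matrix ι κ ℝ}

variable (W W') in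
lemma measurable_signGap_col [Countable κ] [MeasurableSingletonClass κ] :
    Measurable fun p : (ι → ℝ) × κ => signGap (W.col p.2) (W'.col p.2) p.1 :=
  measurable_from_prod_countable_left fun c => measurable_signGap (W.col c) (W'.col c)

variable (W W') in
lemma hasAllMoments_signGap_col_mul_eval [Finite κ] [Nonempty κ] [MeasurableSingletonClass κ]
    (a : ι) :
    HasAllMoments (fun p => signGap (W.col p.2) (W'.col p.2) p.1 * p.1 a) (pairLaw ι κ) :=
  hasAllMoments_pairLaw fun c => (hasAllMoments_signGap (W.col c) (W'.col c)).mul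
    (hasAllMoments_eval_gaussianPi a)

lemma integral_sq_sum_signGap_col_mul_le [Fintype κ] [Nonempty κ] [MeasurableSingletonClass κ]
    (hW : ∀ c, W.col c ⬝ᵥ W.col c = 1) (hW' : ∀ c, W'.col c ⬝ᵥ W'.col c = 1) (u : ι → ℝ) :
    ∫ p, (∑ a, signGap (W.col p.2) (W'.col p.2) p.1 * p.1 a * u a) ^ 2 ∂pairLaw ι κ
      ≤ 168 * ((∑ c, colDist W W' c) / Fintype.card κ) * (u ⬝ᵥ u) := by
  have factor (p : (ι → ℝ) × κ) :
      (∑ a, signGap (W.col p.2) (W'.col p.2) p.1 * p.1 a * u a) ^ 2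
        = signGap (W.col p.2) (W'.col p.2) p.1 ^ 2 * (p.1 ⬝ᵥ u) ^ 2 := by
    simp only [mul_assoc, ← Finset.mul_sum, mul_pow, dotProduct]
  simp only [factor]
  rw [integral_pairLaw fun c => ((hasAllMoments_signGap (W.col c) (W'.col c)).pow 2).mul
    ((hasAllMoments_dotProduct u).pow 2)]
  calc _ ≤ (∑ c, 168 * colDist W W' c * (u ⬝ᵥ u)) / Fintype.card κ :=
        div_le_div_of_nonneg_right (Finset.sum_le_sum fun c _ =>
          integral_signGap_sq_mul_dotProduct_sq_le (hW c) (hW' c) u) (Nat.cast_nonneg _)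
    _ = 168 * ((∑ c, colDist W W' c) / Fintype.card κ) * (u ⬝ᵥ u) := by
        rw [← Finset.sum_mul, ← Finset.mul_sum]
        ring

variable [DecidableEq κ]

variable (W W') in
/-- The contribution `y x e_jᵀ` of a pair `(x, j)`, where `y` is the difference of the one-bit
measurements of `W` and `W'`. -/
noncomputable def gapMatrix (p : (ι → ℝ) × κ) : Matrix ι κ ℝ :=
  Matrix.vecMulVec (signGap (W.col p.2) (W'.col p.2) p.1 • p.1) (Pi.single p.2 1)

lemma gapMatrix_apply {κ : Type*} [DecidableEq κ] {W W' : Matrix ι κ ℝ} (p : (ι → ℝ) × κ) (a : ι)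
    (j : κ) : gapMatrix W W' p a j
      = if p.2 = j then signGap (W.col p.2) (W'.col p.2) p.1 * p.1 a else 0 := by
  simp [gapMatrix, Matrix.vecMulVec_apply, Pi.single_apply, eq_comm]

lemma sum_gapMatrix_mul_gapMatrix {κ : Type*} [Fintype κ] [DecidableEq κ] {W W' : Matrix ι κ ℝ}
    (p : (ι → ℝ) × κ) (a b : ι) :
    ∑ j, gapMatrix W W' p a j * gapMatrix W W' p b j
      = (signGap (W.col p.2) (W'.col p.2) p.1 * p.1 a)
        * (signGap (W.col p.2) (W'.col p.2) p.1 * p.1 b) := by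
  simp [gapMatrix_apply]

variable [MeasurableSingletonClass κ]

lemma measurable_gapMatrix [Countable κ] (a : ι) (j : κ) :
    Measurable fun p => gapMatrix W W' p a j := by
  simp only [gapMatrix_apply]
  exact Measurable.ite (measurable_snd (measurableSet_singleton j))
    ((measurable_signGap_col W W').mul (by fun_prop)) measurable_const

lemma hasAllMoments_gapMatrix [Finite κ] [Nonempty κ] (a : ι) (j : κ) :
    HasAllMoments (fun p => gapMatrix W W' p a j) (pairLaw ι κ) := by
  refine hasAllMoments_pairLaw fun c => ?_
  simp only [gapMatrix_apply]
  split_ifs with h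
  · exact (hasAllMoments_signGap _ _).mul (hasAllMoments_eval_gaussianPi a)
  · exact .const 0

variable [Fintype κ]

lemma integral_gapMatrix (hW : ∀ c, W.col c ⬝ᵥ W.col c = 1)
    (hW' : ∀ c, W'.col c ⬝ᵥ W'.col c = 1) (a : ι) (j : κ) :
    ∫ p, gapMatrix W W' p a j ∂pairLaw ι κ
      = (√(2 / Real.pi) / Fintype.card κ) * (W - W') a j := by
  have mom := (hasAllMoments_signGap (W.col j) (W'.col j)).mul (hasAllMoments_eval_gaussianPi a)
  simp only [gapMatrix_apply]
  rw [integral_pairLaw_of_ne (j := j) (by simpa only [if_true] using mom)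
    fun x c hc => if_neg hc]
  simp only [if_true]
  rw [integral_signGap_mul_eval (hW j) (hW' j), Matrix.sub_apply]
  simp only [Matrix.col_apply]
  ring

variable [Nonempty κ]

lemma sum_covariance_gapMatrix {β : Matrix ι κ ℝ}
    (hβ : ∀ a j, ∫ p, gapMatrix W W' p a j ∂pairLaw ι κ = β a j) (a b : ι) :
    ∑ j, ∫ p, (gapMatrix W W' p - β) a j * (gapMatrix W W' p - β) b j ∂pairLaw ι κ
      = ∫ p, (signGap (W.col p.2) (W'.col p.2) p.1 * p.1 a)
          * (signGap (W.col p.2) (W'.col p.2) p.1 * p.1 b) ∂pairLaw ι κ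
        - ∑ j, β a j * β b j := by
  simp only [Matrix.sub_apply, ← hβ]
  simp only [integral_sub_mul_sub (hasAllMoments_gapMatrix a _) (hasAllMoments_gapMatrix b _),
    Finset.sum_sub_distrib, ← sum_gapMatrix_mul_gapMatrix]
  rw [integral_finsetSum _ fun j _ =>
    ((hasAllMoments_gapMatrix a j).mul (hasAllMoments_gapMatrix b j)).integrable]

lemma sum_sq_covariance_gapMatrix_le (hW : ∀ c, W.col c ⬝ᵥ W.col c = 1)
    (hW' : ∀ c, W'.col c ⬝ᵥ W'.col c = 1) {β : Matrix ι κ ℝ}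
    (hβ : ∀ a j, ∫ p, gapMatrix W W' p a j ∂pairLaw ι κ = β a j) :
    ∑ a, ∑ b, (∑ j, ∫ p, (gapMatrix W W' p - β) a j * (gapMatrix W W' p - β) b j
        ∂pairLaw ι κ) ^ 2
      ≤ 2 * (Fintype.card ι * (168 * ((∑ c, colDist W W' c) / Fintype.card κ)) ^ 2)
        + 2 * (∑ a, ∑ j, β a j ^ 2) ^ 2 := by
  have colDist_sum_nonneg : 0 ≤ ∑ c, colDist W W' c :=
    Finset.sum_nonneg fun c _ => colDist_nonneg W W' c
  have uncentred := sum_sum_sq_integral_mul_le (hasAllMoments_signGap_col_mul_eval W W')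
    (by positivity) (integral_sq_sum_signGap_col_mul_le hW hW')
  have mean : ∑ a, ∑ b, (∑ j, β a j * β b j) ^ 2 ≤ (∑ a, ∑ j, β a j ^ 2) ^ 2 := by
    rw [sq (∑ a, ∑ j, β a j ^ 2), Finset.sum_mul_sum]
    gcongr
    exact Finset.sum_mul_sq_le_sq_mul_sq _ _ _
  have sub_sq_le (s t : ℝ) : (s - t) ^ 2 ≤ 2 * s ^ 2 + 2 * t ^ 2 := by
    linarith [sq_nonneg (s + t)]
  simp only [sum_covariance_gapMatrix hβ]
  refine (Finset.sum_le_sum fun a _ => Finset.sum_le_sum fun b _ => sub_sq_le _ _).trans ?_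
  simp only [Finset.sum_add_distrib, ← Finset.mul_sum]
  linarith

end GapMatrix

end Model

section Deviation

open scoped Matrix

variable {ι κ τ Ω : Type*} [Fintype ι] [Fintype τ]

section Pointwise

variable [DecidableEq κ] (W W' : Matrix ι κ ℝ)

/-- The squared length of the column `j` of `gapMatrix W W'`, an entry of its (diagonal) Gram
matrix. -/
noncomputable def gapWeight (j : κ) (p : (ι → ℝ) × κ) : ℝ :=
  if p.2 = j then signGap (W.col p.2) (W'.col p.2) p.1 ^ 2 * (p.1 ⬝ᵥ p.1) else 0

/-- The squared deviation of the squared length of a Gaussian vector from its mean, on the event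
that the two one-bit measurements differ. It dominates the fluctuations of `gapWeight`. -/
noncomputable def gapFluctuation {κ : Type*} (W W' : Matrix ι κ ℝ) (p : (ι → ℝ) × κ) : ℝ :=
  signGap (W.col p.2) (W'.col p.2) p.1 ^ 2 * (p.1 ⬝ᵥ p.1 - Fintype.card ι) ^ 2

lemma gapFluctuation_nonneg {κ : Type*} (W W' : Matrix ι κ ℝ) (p : (ι → ℝ) × κ) :
    0 ≤ gapFluctuation W W' p :=
  mul_nonneg (sq_nonneg _) (sq_nonneg _)

lemma gapWeight_nonneg (j : κ) (p : (ι → ℝ) × κ) : 0 ≤ gapWeight W W' j p := by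
  unfold gapWeight
  split_ifs
  · exact mul_nonneg (sq_nonneg _) (dotProduct_self_nonneg _)
  · exact le_rfl

lemma gapWeight_sq_le (j : κ) (p : (ι → ℝ) × κ) :
    gapWeight W W' j p ^ 2 ≤ 32 * (Fintype.card ι : ℝ) ^ 2 + 8 * gapFluctuation W W' p := by
  have fluctuation_nonneg := gapFluctuation_nonneg W W' p
  unfold gapWeight
  split_ifs
  · unfold gapFluctuation
    set g := signGap (W.col p.2) (W'.col p.2) p.1 with hg
    set N := p.1 ⬝ᵥ p.1
    have g_sq_le : g ^ 2 ≤ 4 := signGap_sq_le _ _ _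
    have N_sq_le : N ^ 2 ≤ 2 * (Fintype.card ι : ℝ) ^ 2 + 2 * (N - Fintype.card ι) ^ 2 := by
      linarith [sq_nonneg (N - 2 * Fintype.card ι)]
    calc (g ^ 2 * N) ^ 2 = g ^ 4 * N ^ 2 := by ring
      _ = 4 * (g ^ 2 * N ^ 2) := by rw [hg, signGap_pow_four]; ring
      _ ≤ 4 * (g ^ 2 * (2 * (Fintype.card ι : ℝ) ^ 2 + 2 * (N - Fintype.card ι) ^ 2)) := by gcongr
      _ = 8 * g ^ 2 * (Fintype.card ι : ℝ) ^ 2 + 8 * (g ^ 2 * (N - Fintype.card ι) ^ 2) := by ring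
      _ ≤ 8 * 4 * (Fintype.card ι : ℝ) ^ 2 + 8 * (g ^ 2 * (N - Fintype.card ι) ^ 2) := by gcongr
      _ = 32 * (Fintype.card ι : ℝ) ^ 2 + 8 * (g ^ 2 * (N - Fintype.card ι) ^ 2) := by ring
  · rw [zero_pow two_ne_zero]
    positivity

lemma sum_conjTranspose_gapMatrix_mul_gapMatrix (p : τ → (ι → ℝ) × κ) :
    ∑ i, (gapMatrix W W' (p i))ᴴ * gapMatrix W W' (p i)
      = Matrix.diagonal fun j => ∑ i, gapWeight W W' j (p i) := by
  simp only [gapMatrix]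
  rw [sum_conjTranspose_mul_vecMulVec_single
    (fun i => signGap (W.col (p i).2) (W'.col (p i).2) (p i).1 • (p i).1) fun i => (p i).2]
  simp only [gapWeight, smul_dotProduct, dotProduct_smul, smul_eq_mul, ← mul_assoc, ← sq]

lemma l2_opNorm_sum_conjTranspose_gapMatrix_mul_gapMatrix_sq_le [Fintype κ]
    (p : τ → (ι → ℝ) × κ) :
    ‖∑ i, (gapMatrix W W' (p i))ᴴ * gapMatrix W W' (p i)‖ ^ 2
      ≤ (32 * (Fintype.card ι : ℝ) ^ 2 + 8 * ∑ i, gapFluctuation W W' (p i))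
        + 2 * ∑ j, ∑ q ∈ Finset.univ.offDiag,
          gapWeight W W' j (p q.1) * gapWeight W W' j (p q.2) := by
  have sum_nonneg : 0 ≤ ∑ i, gapFluctuation W W' (p i) :=
    Finset.sum_nonneg fun i _ => gapFluctuation_nonneg W W' _
  rw [sum_conjTranspose_gapMatrix_mul_gapMatrix]
  refine l2_opNorm_diagonal_sum_sq_le (fun i j => gapWeight_nonneg W W' j (p i))
    (fun i j => (gapWeight_sq_le W W' j (p i)).trans ?_) (by positivity)
  gcongr
  exact Finset.single_le_sum (f := fun i => gapFluctuation W W' (p i))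
    (fun i _ => gapFluctuation_nonneg W W' _) (Finset.mem_univ i)

lemma l2_opNorm_sum_sub_pow_four_le {m n : Type*} [Fintype m] [Fintype n] [DecidableEq n]
    (B : τ → Matrix m n ℝ) (β : Matrix m n ℝ) :
    ‖∑ i, (B i - β)‖ ^ 4 ≤ 108 * (Fintype.card τ * ∑ a, ∑ j, β a j ^ 2) ^ 2
      + 12 * ‖∑ i, (B i)ᴴ * B i‖ ^ 2
      + 12 * ‖∑ p ∈ Finset.univ.offDiag, (B p.1 - β)ᴴ * (B p.2 - β)‖ ^ 2 := by
  have norm_β : ‖β‖ ^ 2 ≤ ∑ a, ∑ j, β a j ^ 2 := by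
    simpa only [Real.norm_eq_abs, sq_abs] using l2_opNorm_sq_le_sum_norm_sq β
  have sq_le (a b c : ℝ) :
      (2 * a + 2 * b + 6 * c) ^ 2 ≤ 108 * c ^ 2 + 12 * a ^ 2 + 12 * b ^ 2 := by
    linarith [sq_nonneg (2 * a - 2 * b), sq_nonneg (2 * a - 6 * c), sq_nonneg (2 * b - 6 * c)]
  calc ‖∑ i, (B i - β)‖ ^ 4 = (‖∑ i, (B i - β)‖ ^ 2) ^ 2 := by ring
    _ ≤ (2 * ‖∑ i, (B i)ᴴ * B i‖
          + 2 * ‖∑ p ∈ Finset.univ.offDiag, (B p.1 - β)ᴴ * (B p.2 - β)‖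
          + 6 * (Fintype.card τ * ∑ a, ∑ j, β a j ^ 2)) ^ 2 := by
        refine pow_le_pow_left₀ (sq_nonneg _) ((l2_opNorm_sum_sub_sq_le B β).trans ?_) 2
        rw [mul_assoc]
        gcongr
    _ ≤ _ := sq_le _ _ _

end Pointwise

section Expectation

lemma integral_le_add_mul_integral_add_mul_integral [MeasurableSpace Ω] {P : Measure Ω}
    [IsProbabilityMeasure P] {V f g : Ω → ℝ} {a b c : ℝ} (hV : ∀ ω, 0 ≤ V ω)
    (hf : Integrable f P) (hg : Integrable g P) (le : ∀ ω, V ω ≤ c + a * f ω + b * g ω) :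
    ∫ ω, V ω ∂P ≤ c + a * ∫ ω, f ω ∂P + b * ∫ ω, g ω ∂P := by
  have first : Integrable (fun ω => c + a * f ω) P := (integrable_const c).add (hf.const_mul a)
  calc ∫ ω, V ω ∂P ≤ ∫ ω, (c + a * f ω + b * g ω) ∂P :=
        integral_mono_of_nonneg (.of_forall hV) (first.add (hg.const_mul b)) (.of_forall le)
    _ = c + a * ∫ ω, f ω ∂P + b * ∫ ω, g ω ∂P := by
        rw [integral_add first (hg.const_mul b), integral_add (integrable_const c) (hf.const_mul a),
          integral_const, probReal_univ, one_smul, integral_const_mul, integral_const_mul]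

lemma hasAllMoments_gapFluctuation_section (W W' : Matrix ι κ ℝ) (c : κ) :
    HasAllMoments (fun x => gapFluctuation W W' (x, c)) (gaussianPi ι) :=
  ((hasAllMoments_signGap (W.col c) (W'.col c)).pow 2).mul
    ((hasAllMoments_dotProduct_self.sub (.const _)).pow 2)

lemma hasAllMoments_gapWeight_section [DecidableEq κ] (W W' : Matrix ι κ ℝ) (j c : κ) :
    HasAllMoments (fun x => gapWeight W W' j (x, c)) (gaussianPi ι) := by
  dsimp only [gapWeight]
  split_ifs
  · exact ((hasAllMoments_signGap (W.col c) (W'.col c)).pow 2).mul hasAllMoments_dotProduct_self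
  · exact .const 0

variable [MeasurableSpace κ] [MeasurableSingletonClass κ] [MeasurableSpace Ω] {P : Measure Ω}

lemma measurable_gapFluctuation [Countable κ] (W W' : Matrix ι κ ℝ) :
    Measurable (gapFluctuation W W') :=
  ((measurable_signGap_col W W').pow_const 2).mul (by fun_prop)

lemma measurable_gapWeight [Countable κ] [DecidableEq κ] (W W' : Matrix ι κ ℝ) (j : κ) :
    Measurable (gapWeight W W' j) :=
  Measurable.ite (measurable_snd (measurableSet_singleton j))
    (((measurable_signGap_col W W').pow_const 2).mul (by fun_prop)) measurable_const

variable {W W' : Matrix ι κ ℝ} [Fintype κ]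

lemma integral_gapFluctuation_le (hW : ∀ c, W.col c ⬝ᵥ W.col c = 1)
    (hW' : ∀ c, W'.col c ⬝ᵥ W'.col c = 1) :
    ∫ p, gapFluctuation W W' p ∂pairLaw ι κ
      ≤ 3864 * Fintype.card ι * (∑ c, colDist W W' c) / Fintype.card κ := by
  rw [integral_pairLaw (hasAllMoments_gapFluctuation_section W W'), Finset.mul_sum]
  dsimp only [gapFluctuation, colDist]
  exact div_le_div_of_nonneg_right (Finset.sum_le_sum fun c _ =>
    integral_signGap_sq_mul_normSq_sub_card_sq_le (hW c) (hW' c)) (Nat.cast_nonneg _)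

lemma integral_signGap_sq_mul_dotProduct_self_le {w w' : ι → ℝ} (hw : w ⬝ᵥ w = 1)
    (hw' : w' ⬝ᵥ w' = 1) :
    ∫ x, signGap w w' x ^ 2 * (x ⬝ᵥ x) ∂gaussianPi ι
      ≤ 168 * Fintype.card ι * √((w - w') ⬝ᵥ (w - w')) := by
  classical
  have expand (x : ι → ℝ) : signGap w w' x ^ 2 * (x ⬝ᵥ x)
      = ∑ a, signGap w w' x ^ 2 * (x ⬝ᵥ Pi.single a 1) ^ 2 := by
    simp only [dotProduct_single, mul_one, ← Finset.mul_sum]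
    simp only [dotProduct, sq]
  simp only [expand]
  rw [integral_finsetSum _ fun a _ => (((hasAllMoments_signGap w w').pow 2).mul
    ((hasAllMoments_dotProduct _).pow 2)).integrable]
  calc _ ≤ ∑ a : ι, 168 * √((w - w') ⬝ᵥ (w - w')) * ((Pi.single a 1 : ι → ℝ) ⬝ᵥ Pi.single a 1) :=
        Finset.sum_le_sum fun a _ => integral_signGap_sq_mul_dotProduct_sq_le hw hw' _
    _ = 168 * Fintype.card ι * √((w - w') ⬝ᵥ (w - w')) := by
        simp only [dotProduct_single, Pi.single_eq_same, mul_one, Finset.sum_const, nsmul_eq_mul,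
          Finset.card_univ]
        ring

lemma integral_gapWeight_le [DecidableEq κ] {j : κ} (hW : W.col j ⬝ᵥ W.col j = 1)
    (hW' : W'.col j ⬝ᵥ W'.col j = 1) :
    ∫ p, gapWeight W W' j p ∂pairLaw ι κ
      ≤ 168 * Fintype.card ι * colDist W W' j / Fintype.card κ := by
  rw [integral_pairLaw_of_ne (hasAllMoments_gapWeight_section W W' j j) fun x c hc => if_neg hc]
  refine div_le_div_of_nonneg_right ?_ (Nat.cast_nonneg _)
  simp only [gapWeight, if_true]
  exact integral_signGap_sq_mul_dotProduct_self_le hW hW'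

lemma integral_sum_offDiag_mul_le {S : Type*} [MeasurableSpace S] {μ : Measure S}
    {ξ : τ → Ω → S} (hlaw : ∀ i, HasLaw (ξ i) μ P) (hind : iIndepFun ξ P) {f : S → ℝ}
    (measurable : Measurable f) (moments : HasAllMoments f μ) :
    ∫ ω, ∑ q ∈ Finset.univ.offDiag, f (ξ q.1 ω) * f (ξ q.2 ω) ∂P
      ≤ (Fintype.card τ * ∫ s, f s ∂μ) ^ 2 := by
  classical
  have mean (i : τ) : ∫ ω, f (ξ i ω) ∂P = ∫ s, f s ∂μ :=
    (hlaw i).integral_comp measurable.aestronglyMeasurable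
  have product {q : τ × τ} (hq : q ∈ Finset.univ.offDiag) :
      ∫ ω, f (ξ q.1 ω) * f (ξ q.2 ω) ∂P = (∫ s, f s ∂μ) ^ 2 := by
    rw [(hind.indepFun (Finset.mem_offDiag.1 hq).2.2).integral_fun_comp_mul_comp
      (hlaw _).aemeasurable (hlaw _).aemeasurable measurable.aestronglyMeasurable
      measurable.aestronglyMeasurable, mean, mean, ← sq]
  rw [integral_finsetSum _ fun q _ => ((moments.comp_hasLaw (hlaw q.1)).mul
    (moments.comp_hasLaw (hlaw q.2))).integrable, Finset.sum_congr rfl fun q hq => product hq,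
    Finset.sum_const, nsmul_eq_mul, mul_pow, Finset.offDiag_card, Finset.card_univ]
  exact mul_le_mul_of_nonneg_right (mod_cast (Nat.sub_le _ _).trans_eq (sq _).symm) (sq_nonneg _)

variable [Nonempty κ] {ξ : τ → Ω → (ι → ℝ) × κ}

lemma integral_sum_gapFluctuation_le (hlaw : ∀ i, HasLaw (ξ i) (pairLaw ι κ) P)
    (hW : ∀ c, W.col c ⬝ᵥ W.col c = 1) (hW' : ∀ c, W'.col c ⬝ᵥ W'.col c = 1) :
    ∫ ω, ∑ i, gapFluctuation W W' (ξ i ω) ∂P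
      ≤ 3864 * Fintype.card ι * (Fintype.card τ / Fintype.card κ * ∑ c, colDist W W' c) := by
  have moments := hasAllMoments_pairLaw (hasAllMoments_gapFluctuation_section W W')
  have mean (i : τ) : ∫ ω, gapFluctuation W W' (ξ i ω) ∂P
      = ∫ p, gapFluctuation W W' p ∂pairLaw ι κ :=
    (hlaw i).integral_comp (measurable_gapFluctuation W W').aestronglyMeasurable
  rw [integral_finsetSum _ fun i _ => (moments.comp_hasLaw (hlaw i)).integrable]
  simp only [mean, Finset.sum_const, nsmul_eq_mul, Finset.card_univ]
  calc _ ≤ Fintype.card τ * (3864 * Fintype.card ι * (∑ c, colDist W W' c) / Fintype.card κ) :=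
        mul_le_mul_of_nonneg_left (integral_gapFluctuation_le hW hW') (Nat.cast_nonneg _)
    _ = _ := by ring

variable [DecidableEq κ]

lemma integral_sum_offDiag_gapWeight_mul_le (hlaw : ∀ i, HasLaw (ξ i) (pairLaw ι κ) P)
    (hind : iIndepFun ξ P) {j : κ} (hW : W.col j ⬝ᵥ W.col j = 1)
    (hW' : W'.col j ⬝ᵥ W'.col j = 1) :
    ∫ ω, ∑ q ∈ Finset.univ.offDiag,
        gapWeight W W' j (ξ q.1 ω) * gapWeight W W' j (ξ q.2 ω) ∂P
      ≤ (168 * Fintype.card ι * (Fintype.card τ / Fintype.card κ)) ^ 2 * colDist W W' j ^ 2 := by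
  have nonneg : 0 ≤ ∫ p, gapWeight W W' j p ∂pairLaw ι κ :=
    integral_nonneg fun p => gapWeight_nonneg W W' j p
  calc _ ≤ (Fintype.card τ * ∫ p, gapWeight W W' j p ∂pairLaw ι κ) ^ 2 :=
        integral_sum_offDiag_mul_le hlaw hind (measurable_gapWeight W W' j)
          (hasAllMoments_pairLaw (hasAllMoments_gapWeight_section W W' j))
    _ ≤ (Fintype.card τ * (168 * Fintype.card ι * colDist W W' j / Fintype.card κ)) ^ 2 := by
        gcongr
        exact integral_gapWeight_le hW hW'
    _ = _ := by ring

variable [IsProbabilityMeasure P]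

lemma integral_l2_opNorm_diag_gram_sq_le (hlaw : ∀ i, HasLaw (ξ i) (pairLaw ι κ) P)
    (hind : iIndepFun ξ P) (hW : ∀ c, W.col c ⬝ᵥ W.col c = 1)
    (hW' : ∀ c, W'.col c ⬝ᵥ W'.col c = 1) :
    ∫ ω, ‖∑ i, (gapMatrix W W' (ξ i ω))ᴴ * gapMatrix W W' (ξ i ω)‖ ^ 2 ∂P
      ≤ 32 * (Fintype.card ι : ℝ) ^ 2
        + 8 * (3864 * Fintype.card ι * (Fintype.card τ / Fintype.card κ * ∑ c, colDist W W' c))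
        + 2 * ((168 * Fintype.card ι * (Fintype.card τ / Fintype.card κ)) ^ 2
          * ∑ a, ∑ c, (W - W') a c ^ 2) := by
  have weight (j : κ) (i : τ) : HasAllMoments (fun ω => gapWeight W W' j (ξ i ω)) P :=
    (hasAllMoments_pairLaw (hasAllMoments_gapWeight_section W W' j)).comp_hasLaw (hlaw i)
  have pair (j : κ) : HasAllMoments (fun ω => ∑ q ∈ Finset.univ.offDiag,
      gapWeight W W' j (ξ q.1 ω) * gapWeight W W' j (ξ q.2 ω)) P :=
    .sum fun q _ => (weight j q.1).mul (weight j q.2)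
  have pairs : HasAllMoments (fun ω => ∑ j, ∑ q ∈ Finset.univ.offDiag,
      gapWeight W W' j (ξ q.1 ω) * gapWeight W W' j (ξ q.2 ω)) P :=
    .sum fun j _ => pair j
  have fluctuation : HasAllMoments (fun ω => ∑ i, gapFluctuation W W' (ξ i ω)) P :=
    .sum fun i _ =>
      (hasAllMoments_pairLaw (hasAllMoments_gapFluctuation_section W W')).comp_hasLaw (hlaw i)
  refine (integral_le_add_mul_integral_add_mul_integral (fun _ => sq_nonneg _)
    fluctuation.integrable pairs.integrable fun ω =>
      l2_opNorm_sum_conjTranspose_gapMatrix_mul_gapMatrix_sq_le W W' fun i => ξ i ω).trans ?_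
  rw [← sum_colDist_sq, Finset.mul_sum Finset.univ (fun c => colDist W W' c ^ 2),
    integral_finsetSum _ fun j _ => (pair j).integrable]
  gcongr with j
  · exact integral_sum_gapFluctuation_le hlaw hW hW'
  · exact integral_sum_offDiag_gapWeight_mul_le hlaw hind (hW j) (hW' j)

lemma integral_l2_opNorm_offDiag_gapMatrix_gram_sq_le
    (hlaw : ∀ i, HasLaw (ξ i) (pairLaw ι κ) P) (hind : iIndepFun ξ P)
    (hW : ∀ c, W.col c ⬝ᵥ W.col c = 1) (hW' : ∀ c, W'.col c ⬝ᵥ W'.col c = 1)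
    {β : Matrix ι κ ℝ} (hβ : ∀ a j, ∫ p, gapMatrix W W' p a j ∂pairLaw ι κ = β a j) :
    ∫ ω, ‖∑ q ∈ Finset.univ.offDiag,
        (gapMatrix W W' (ξ q.1 ω) - β)ᴴ * (gapMatrix W W' (ξ q.2 ω) - β)‖ ^ 2 ∂P
      ≤ 4 * 168 ^ 2 * (Fintype.card ι
          * (Fintype.card τ / Fintype.card κ * ∑ c, colDist W W' c) ^ 2)
        + 4 * (Fintype.card τ * ∑ a, ∑ j, β a j ^ 2) ^ 2 := by
  have centred (a : ι) (j : κ) : ∫ p, (gapMatrix W W' p - β) a j ∂pairLaw ι κ = 0 := by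
    simp only [Matrix.sub_apply]
    rw [integral_sub (hasAllMoments_gapMatrix a j).integrable (integrable_const _), hβ,
      integral_const, probReal_univ, one_smul, sub_self]
  refine (integral_l2_opNorm_offDiag_gram_sq_le hlaw hind
    (M := fun p => gapMatrix W W' p - β) (fun a j => (measurable_gapMatrix a j).sub_const _)
    (fun a j => (hasAllMoments_gapMatrix a j).sub (.const _)) centred).trans ?_
  calc _ ≤ _ := mul_le_mul_of_nonneg_left (sum_sq_covariance_gapMatrix_le hW hW' hβ)
        (by positivity)
    _ = _ := by ring

lemma integral_l2_opNorm_sum_gapMatrix_sub_pow_four_le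
    (hlaw : ∀ i, HasLaw (ξ i) (pairLaw ι κ) P) (hind : iIndepFun ξ P)
    (hW : ∀ c, W.col c ⬝ᵥ W.col c = 1) (hW' : ∀ c, W'.col c ⬝ᵥ W'.col c = 1)
    {β : Matrix ι κ ℝ} (hβ : ∀ a j, ∫ p, gapMatrix W W' p a j ∂pairLaw ι κ = β a j) :
    ∫ ω, ‖∑ i, (gapMatrix W W' (ξ i ω) - β)‖ ^ 4 ∂P
      ≤ 108 * (Fintype.card τ * ∑ a, ∑ j, β a j ^ 2) ^ 2
        + 12 * (32 * (Fintype.card ι : ℝ) ^ 2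
          + 8 * (3864 * Fintype.card ι * (Fintype.card τ / Fintype.card κ * ∑ c, colDist W W' c))
          + 2 * ((168 * Fintype.card ι * (Fintype.card τ / Fintype.card κ)) ^ 2
            * ∑ a, ∑ c, (W - W') a c ^ 2))
        + 12 * (4 * 168 ^ 2 * (Fintype.card ι
            * (Fintype.card τ / Fintype.card κ * ∑ c, colDist W W' c) ^ 2)
          + 4 * (Fintype.card τ * ∑ a, ∑ j, β a j ^ 2) ^ 2) := by
  have entry (i : τ) (a : ι) (j : κ) :
      HasAllMoments (fun ω => gapMatrix W W' (ξ i ω) a j) P :=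
    (hasAllMoments_gapMatrix a j).comp_hasLaw (hlaw i)
  have diag : HasAllMoments
      (fun ω => ‖∑ i, (gapMatrix W W' (ξ i ω))ᴴ * gapMatrix W W' (ξ i ω)‖ ^ 2) P := by
    refine (hasAllMoments_l2_opNorm fun j l => ?_).pow 2
    simp only [Matrix.sum_apply, Matrix.mul_apply, Matrix.conjTranspose_apply, star_trivial]
    exact .sum fun i _ => .sum fun a _ => (entry i a j).mul (entry i a l)
  have offDiag : HasAllMoments (fun ω => ‖∑ q ∈ Finset.univ.offDiag,
      (gapMatrix W W' (ξ q.1 ω) - β)ᴴ * (gapMatrix W W' (ξ q.2 ω) - β)‖ ^ 2) P := by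
    refine (hasAllMoments_l2_opNorm fun j l => ?_).pow 2
    simp only [Matrix.sum_apply, Matrix.mul_apply, Matrix.conjTranspose_apply, star_trivial,
      Matrix.sub_apply]
    exact .sum fun q _ => .sum fun a _ =>
      ((entry q.1 a j).sub (.const _)).mul ((entry q.2 a l).sub (.const _))
  refine (integral_le_add_mul_integral_add_mul_integral (fun _ => by positivity)
    diag.integrable offDiag.integrable fun ω =>
      l2_opNorm_sum_sub_pow_four_le (fun i => gapMatrix W W' (ξ i ω)) β).trans ?_
  gcongr
  · exact integral_l2_opNorm_diag_gram_sq_le hlaw hind hW hW'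
  · exact integral_l2_opNorm_offDiag_gapMatrix_gram_sq_le hlaw hind hW hW' hβ

end Expectation

section Simplification

lemma sq_mul_sum_colDist_le [Fintype κ] (W W' : Matrix ι κ ℝ) (ρ : ℝ) :
    (ρ * ∑ c, colDist W W' c) ^ 2
      ≤ Fintype.card κ * (ρ ^ 2 * ∑ a, ∑ c, (W - W') a c ^ 2) := by
  calc (ρ * ∑ c, colDist W W' c) ^ 2 = ρ ^ 2 * (∑ c, colDist W W' c) ^ 2 := mul_pow _ _ 2
    _ ≤ ρ ^ 2 * (Fintype.card κ * ∑ c, colDist W W' c ^ 2) := by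
        gcongr
        exact sq_sum_le_card_mul_sum_sq
    _ = _ := by rw [sum_colDist_sq, mul_left_comm]

lemma sum_sum_sub_sq_le [Fintype κ] {W W' : Matrix ι κ ℝ} (hW : ∀ c, W.col c ⬝ᵥ W.col c = 1)
    (hW' : ∀ c, W'.col c ⬝ᵥ W'.col c = 1) :
    ∑ a, ∑ c, (W - W') a c ^ 2 ≤ 4 * Fintype.card κ := by
  rw [← sum_colDist_sq, mul_comm, ← nsmul_eq_mul]
  exact Finset.sum_le_card_nsmul _ _ _ fun c _ => colDist_sq_le (hW c) (hW' c)

lemma sum_sum_smul_sub_sq [Fintype κ] (W W' : Matrix ι κ ℝ) (d : ℝ) :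
    ∑ a, ∑ c, ((√(2 / Real.pi) / d) • (W - W')) a c ^ 2
      = 2 / Real.pi / d ^ 2 * ∑ a, ∑ c, (W - W') a c ^ 2 := by
  simp only [Matrix.smul_apply, smul_eq_mul, mul_pow, ← Finset.mul_sum, div_pow]
  rw [Real.sq_sqrt (by positivity)]

lemma sq_mul_two_div_pi_mul_le {m d F : ℝ} (hd : 1 ≤ d) (hF : 0 ≤ F) (hFd : F ≤ 4 * d) :
    (m * (2 / Real.pi / d ^ 2 * F)) ^ 2 ≤ 4 * ((m / d) ^ 2 * F) := by
  have two_div_pi_le : 2 / Real.pi ≤ 1 := (div_le_one Real.pi_pos).2 Real.two_le_pi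
  have F_div_le : F / d ^ 2 ≤ 4 := by
    rw [div_le_iff₀ (by positivity)]
    nlinarith
  calc (m * (2 / Real.pi / d ^ 2 * F)) ^ 2
      = (2 / Real.pi) ^ 2 * ((m / d) ^ 2 * F) * (F / d ^ 2) := by field_simp
    _ ≤ 1 ^ 2 * ((m / d) ^ 2 * F) * 4 := by gcongr
    _ = 4 * ((m / d) ^ 2 * F) := by ring

lemma moment_bound_le {N D q s b : ℝ} (hN : 0 ≤ N) (hND : N ≤ D) (hD : 1 ≤ D) (hq : 0 ≤ q)
    (hs : s ^ 2 ≤ D * q) (hb : b ≤ 4 * q) :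
    108 * b + 12 * (32 * N ^ 2 + 8 * (3864 * N * s) + 2 * (168 ^ 2 * N ^ 2 * q))
        + 12 * (4 * 168 ^ 2 * (N * s ^ 2) + 4 * b)
      ≤ 2404080 * D ^ 2 * (1 + q) := by
  have s_le : s ≤ D * (1 + q) := by
    nlinarith [sq_nonneg (s - 1), mul_nonneg (zero_le_one.trans hD) hq]
  have N_sq_le : N ^ 2 ≤ D ^ 2 := pow_le_pow_left₀ hN hND 2
  have linear : N * s ≤ D ^ 2 * (1 + q) := by
    calc N * s ≤ N * (D * (1 + q)) := by gcongr
      _ ≤ D * (D * (1 + q)) := by gcongr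
      _ = D ^ 2 * (1 + q) := by ring
  have quadratic : N * s ^ 2 ≤ D ^ 2 * q := by
    calc N * s ^ 2 ≤ N * (D * q) := by gcongr
      _ ≤ D * (D * q) := by gcongr
      _ = D ^ 2 * q := by ring
  have diagonal : N ^ 2 * q ≤ D ^ 2 * q := by gcongr
  have mean : q ≤ D ^ 2 * q := le_mul_of_one_le_left hq (one_le_pow₀ hD)
  linarith [sq_nonneg D]

end Simplification

theorem integral_l2_opNorm_sum_gapMatrix_sub_smul_pow_four_le [Fintype κ] [Nonempty κ]
    [DecidableEq κ] [MeasurableSpace κ] [MeasurableSingletonClass κ] [MeasurableSpace Ω]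
    {P : Measure Ω} [IsProbabilityMeasure P] {W W' : Matrix ι κ ℝ} {ξ : τ → Ω → (ι → ℝ) × κ}
    (hlaw : ∀ i, HasLaw (ξ i) (pairLaw ι κ) P) (hind : iIndepFun ξ P)
    (hW : ∀ c, W.col c ⬝ᵥ W.col c = 1) (hW' : ∀ c, W'.col c ⬝ᵥ W'.col c = 1) {D : ℝ}
    (hι : Fintype.card ι ≤ D) (hκ : Fintype.card κ ≤ D) :
    ∫ ω, ‖∑ i, (gapMatrix W W' (ξ i ω) - (√(2 / Real.pi) / Fintype.card κ) • (W - W'))‖ ^ 4 ∂P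
      ≤ 2404080 * D ^ 2 * (1 + (Fintype.card τ / Fintype.card κ) ^ 2
        * ∑ a, ∑ c, (W - W') a c ^ 2) := by
  have card_pos : (1 : ℝ) ≤ Fintype.card κ := mod_cast Fintype.card_pos
  have F_nonneg : 0 ≤ ∑ a, ∑ c, (W - W') a c ^ 2 := by positivity
  refine (integral_l2_opNorm_sum_gapMatrix_sub_pow_four_le hlaw hind hW hW'
    (β := (√(2 / Real.pi) / Fintype.card κ) • (W - W')) (integral_gapMatrix hW hW')).trans ?_
  rw [sum_sum_smul_sub_sq, mul_pow (168 * (Fintype.card ι : ℝ)), mul_pow 168,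
    mul_assoc (168 ^ 2 * _)]
  refine moment_bound_le (Nat.cast_nonneg _) hι (card_pos.trans hκ) (by positivity)
    ((sq_mul_sum_colDist_le W W' _).trans ?_)
    (sq_mul_two_div_pi_mul_le card_pos F_nonneg (sum_sum_sub_sq_le hW hW'))
  gcongr

end Deviation

section Estimator

variable {d₁ d₂ m : ℕ}

lemma sign_mul_of_pos {s : ℝ} (hs : 0 < s) (t : ℝ) : sign (s * t) = sign t := by
  simp only [sign, mul_nonneg_iff_of_pos_left hs]

lemma sensing_apply (x : Fin m → Fin d₁ → ℝ) (j : Fin m → Fin d₂)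
    (W : Matrix (Fin d₁) (Fin d₂) ℝ) (i : Fin m) :
    sensing x j W i = √(d₂ : ℝ) * (x i ⬝ᵥ W.col (j i)) := by
  simp only [sensing, inner, sensingMatrix, scaledOneHot, Matrix.vecMulVec_apply, Pi.smul_apply,
    Pi.single_apply, smul_eq_mul, mul_ite, mul_one, mul_zero, ite_mul, zero_mul,
    Finset.sum_ite_eq', Finset.mem_univ, if_true, dotProduct, Matrix.col_apply, Finset.mul_sum]
  exact Finset.sum_congr rfl fun a _ => by ring

lemma sensingMatrix_eq (x : Fin d₁ → ℝ) (j : Fin d₂) :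
    sensingMatrix x j = √(d₂ : ℝ) • Matrix.vecMulVec x (Pi.single j 1) := by
  rw [sensingMatrix, scaledOneHot, Matrix.vecMulVec_smul]

lemma sensingAdjoint_sign_sub (x : Fin m → Fin d₁ → ℝ) (j : Fin m → Fin d₂)
    (W W' : Matrix (Fin d₁) (Fin d₂) ℝ) :
    sensingAdjoint x j (fun i => sign (sensing x j W i))
        - sensingAdjoint x j (fun i => sign (sensing x j W' i))
      = √(d₂ : ℝ) • ∑ i, gapMatrix W W' (x i, j i) := by
  simp only [sensingAdjoint, ← Finset.sum_sub_distrib, ← sub_smul, Finset.smul_sum]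
  refine Finset.sum_congr rfl fun i _ => ?_
  have sqrt_pos : 0 < √(d₂ : ℝ) := Real.sqrt_pos.2 (mod_cast (j i).pos)
  rw [sensing_apply, sensing_apply, sign_mul_of_pos sqrt_pos, sign_mul_of_pos sqrt_pos,
    sensingMatrix_eq, smul_comm, gapMatrix, Matrix.smul_vecMulVec]
  rfl

/-- The error made when `W - W'` is estimated by the rescaled back-projection of the difference of
the one-bit measurements of `W` and `W'`. -/
noncomputable def estimationError (x : Fin m → Fin d₁ → ℝ) (j : Fin m → Fin d₂)
    (W W' : Matrix (Fin d₁) (Fin d₂) ℝ) : Matrix (Fin d₁) (Fin d₂) ℝ :=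
  (√(d₂ : ℝ) / (√(2 / Real.pi) * m)) •
    (sensingAdjoint x j (fun i => sign (sensing x j W i))
      - sensingAdjoint x j (fun i => sign (sensing x j W' i))) - (W - W')

lemma smul_estimationError (hd₂ : d₂ ≠ 0) (hm : m ≠ 0) (x : Fin m → Fin d₁ → ℝ)
    (j : Fin m → Fin d₂) (W W' : Matrix (Fin d₁) (Fin d₂) ℝ) :
    (√(2 / Real.pi) * (m / d₂)) • estimationError x j W W'
      = ∑ i, (gapMatrix W W' (x i, j i) - (√(2 / Real.pi) / d₂) • (W - W')) := by
  have d₂_ne_zero : (d₂ : ℝ) ≠ 0 := mod_cast hd₂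
  have m_ne_zero : (m : ℝ) ≠ 0 := mod_cast hm
  have lambda_ne_zero : √(2 / Real.pi) ≠ 0 := (Real.sqrt_pos.2 (by positivity)).ne'
  have unit : √(2 / Real.pi) * (m / d₂) * (√(d₂ : ℝ) / (√(2 / Real.pi) * m) * √(d₂ : ℝ)) = 1 := by
    rw [div_mul_eq_mul_div, Real.mul_self_sqrt (Nat.cast_nonneg _)]
    field_simp
  rw [estimationError, sensingAdjoint_sign_sub, smul_smul, smul_sub, smul_smul, unit, one_smul,
    Finset.sum_sub_distrib, Finset.sum_const, Finset.card_univ, Fintype.card_fin,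
    ← Nat.cast_smul_eq_nsmul ℝ, smul_smul]
  congr 2
  ring

variable {k : ℕ} {W W' : Matrix (Fin d₁) (Fin d₂) ℝ}

lemma col_dotProduct_self_of_mem_normalizedRankLE (hW : W ∈ normalizedRankLE d₁ d₂ k)
    (c : Fin d₂) : W.col c ⬝ᵥ W.col c = 1 := by
  have norm_eq := hW.2 c
  rw [EuclideanSpace.norm_eq, Real.sqrt_eq_one] at norm_eq
  simpa [dotProduct, Matrix.col, sq] using norm_eq

lemma pos_of_mem_normalizedRankLE (hd₂ : d₂ ≠ 0) (hW : W ∈ normalizedRankLE d₁ d₂ k) :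
    0 < k := by
  have unit := col_dotProduct_self_of_mem_normalizedRankLE hW ⟨0, Nat.pos_of_ne_zero hd₂⟩
  refine Nat.pos_of_ne_zero fun hk => ?_
  have range_eq_bot : LinearMap.range W.mulVecLin = ⊥ :=
    Submodule.finrank_eq_zero.1 (Nat.le_zero.1 (hW.1.trans_eq hk))
  have W_eq_zero : W = 0 := Matrix.toLin'.map_eq_zero_iff.1 (LinearMap.range_eq_bot.1 range_eq_bot)
  simp [W_eq_zero, dotProduct] at unit

lemma rank_sub_le {ι κ K : Type*} [Finite ι] [Fintype κ] [Field K] (A B : Matrix ι κ K) :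
    (A - B).rank ≤ A.rank + B.rank := by
  refine (Submodule.finrank_mono ?_).trans (Submodule.finrank_add_le_finrank_add_finrank
    (LinearMap.range A.mulVecLin) (LinearMap.range B.mulVecLin))
  rintro _ ⟨v, rfl⟩
  rw [Matrix.mulVecLin_apply, Matrix.sub_mulVec]
  exact sub_mem (Submodule.mem_sup_left ⟨v, rfl⟩) (Submodule.mem_sup_right ⟨v, rfl⟩)

lemma sum_sum_sub_sq_le_of_mem_normalizedRankLE (hW : W ∈ normalizedRankLE d₁ d₂ k)
    (hW' : W' ∈ normalizedRankLE d₁ d₂ k) :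
    ∑ a, ∑ c, (W - W') a c ^ 2 ≤ 2 * k * ‖W - W'‖ ^ 2 := by
  have rank_le : (W - W').rank ≤ 2 * k :=
    (rank_sub_le W W').trans ((add_le_add hW.1 hW'.1).trans_eq (two_mul k).symm)
  calc ∑ a, ∑ c, (W - W') a c ^ 2 ≤ (W - W').rank * ‖W - W'‖ ^ 2 := by
        simpa only [Real.norm_eq_abs, sq_abs] using sum_norm_sq_le_rank_mul_l2_opNorm_sq (W - W')
    _ ≤ 2 * k * ‖W - W'‖ ^ 2 := by
        gcongr
        exact_mod_cast rank_le

variable {Ω : Type*} [MeasurableSpace Ω] {P : Measure Ω} [IsProbabilityMeasure P]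

lemma IsSample.hasLaw_pair {x : Fin m → Ω → Fin d₁ → ℝ} {j : Fin m → Ω → Fin d₂}
    (h : IsSample P x j) (i : Fin m) :
    HasLaw (fun ω => (x i ω, j i ω)) (pairLaw (Fin d₁) (Fin d₂)) P :=
  (h.indep_pair i).hasLaw_prod (h.law_x i) (h.law_j i)

lemma one_sub_le_measureReal_of_integral_le {V : Ω → ℝ} (hV : Integrable V P)
    (nonneg : ∀ ω, 0 ≤ V ω) {ε η : ℝ} (hε : 0 < ε) (h : ∫ ω, V ω ∂P ≤ η * ε) {s : Set Ω}
    (hs : ∀ ω, ω ∉ s → ε ≤ V ω) : 1 - η ≤ P.real s := by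
  have bad_le : P.real {ω | ε ≤ V ω} ≤ η :=
    le_of_mul_le_mul_left ((mul_meas_ge_le_integral_of_nonneg (.of_forall nonneg) hV ε).trans
      (h.trans_eq (mul_comm η ε))) hε
  have cover : P.real Set.univ ≤ P.real s + P.real {ω | ε ≤ V ω} :=
    (measureReal_mono fun ω _ => or_iff_not_imp_left.2 (hs ω)).trans (measureReal_union_le _ _)
  rw [probReal_univ] at cover
  linarith

theorem one_sub_le_measureReal_norm_estimationError_le (hd₂ : d₂ ≠ 0) (hm : m ≠ 0)
    {x : Fin m → Ω → Fin d₁ → ℝ} {j : Fin m → Ω → Fin d₂} (h : IsSample P x j)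
    (hW : ∀ c, W.col c ⬝ᵥ W.col c = 1) (hW' : ∀ c, W'.col c ⬝ᵥ W'.col c = 1) {D ε η : ℝ}
    (hd₁D : d₁ ≤ D) (hd₂D : d₂ ≤ D) (hε : 0 < ε)
    (hη : 2404080 * D ^ 2 * (1 + (m / d₂) ^ 2 * ∑ a, ∑ c, (W - W') a c ^ 2)
      ≤ η * (√(2 / Real.pi) * (m / d₂) * ε) ^ 4) :
    1 - η ≤ P.real {ω | ‖estimationError (fun i => x i ω) (fun i => j i ω) W W'‖ ≤ ε} := by
  have : NeZero d₂ := ⟨hd₂⟩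
  have scale_pos : 0 < √(2 / Real.pi) * (m / d₂) := by positivity
  have moments : HasAllMoments (fun ω =>
      ‖∑ i, (gapMatrix W W' (x i ω, j i ω) - (√(2 / Real.pi) / d₂) • (W - W'))‖) P := by
    refine hasAllMoments_l2_opNorm fun a c => ?_
    simp only [Matrix.sum_apply, Matrix.sub_apply]
    exact .sum fun i _ =>
      ((hasAllMoments_gapMatrix a c).comp_hasLaw (h.hasLaw_pair i)).sub (.const _)
  have fourth_moment_le := integral_l2_opNorm_sum_gapMatrix_sub_smul_pow_four_le
    (D := D) (fun i => h.hasLaw_pair i) h.indep hW hW' (by simpa using hd₁D) (by simpa using hd₂D)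
  simp only [Fintype.card_fin] at fourth_moment_le
  refine one_sub_le_measureReal_of_integral_le (moments.pow 4).integrable
    (fun ω => by positivity) (by positivity) (fourth_moment_le.trans hη) fun ω hω => ?_
  rw [Set.mem_ofPred_eq, not_le] at hω
  rw [← smul_estimationError hd₂ hm, norm_smul, Real.norm_of_nonneg scale_pos.le]
  gcongr

end Estimator

section SampleSize

variable {C C' L M d k δ ρ z : ℝ}

lemma mul_sqrt_le_of_sample_size (hd : 0 < d) (hk : 0 < k) (hδ : 0 < δ) (hC' : 0 < C')
    (hL : L * C' ≤ C) (hρ : C * d * √k / δ ^ 2 ≤ ρ) :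
    L * √d ≤ ρ * (δ * (δ / (C' * √d * √k))) := by
  rw [show ρ * (δ * (δ / (C' * √d * √k))) = ρ * δ ^ 2 / (C' * √d * √k) by ring,
    le_div_iff₀ (by positivity)]
  calc L * √d * (C' * √d * √k) = L * C' * (√d * √d) * √k := by ring
    _ = L * C' * d * √k := by rw [Real.mul_self_sqrt hd.le]
    _ ≤ C * d * √k := by gcongr
    _ ≤ ρ * δ ^ 2 := (div_le_iff₀ (by positivity)).1 hρ

lemma mul_sq_mul_sq_le_of_sample_size (hC : 0 ≤ C) (hd : 0 ≤ d) (hk : 0 ≤ k) (hδ : 0 < δ)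
    (hρ : C * d * √k / δ ^ 2 ≤ ρ) (hz : 0 ≤ z) (hM : √z ≤ M) :
    (C * d) ^ 2 * (ρ ^ 2 * (k * z ^ 2)) ≤ (ρ * (δ * M)) ^ 4 := by
  have sample : C * d * √k ≤ ρ * δ ^ 2 := (div_le_iff₀ (by positivity)).1 hρ
  calc (C * d) ^ 2 * (ρ ^ 2 * (k * z ^ 2)) = (C * d * √k) ^ 2 * (ρ ^ 2 * (√z ^ 2) ^ 2) := by
        rw [mul_pow _ √k, Real.sq_sqrt hk, Real.sq_sqrt hz]
        ring
    _ ≤ (ρ * δ ^ 2) ^ 2 * (ρ ^ 2 * (M ^ 2) ^ 2) := by gcongr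
    _ = (ρ * (δ * M)) ^ 4 := by ring

lemma moment_le_of_sample_size {K l η : ℝ} (hK : 0 ≤ K) (hl : 0 < l) (hη : 0 < η) (hC' : 0 < C')
    (hd : 1 ≤ d) (hk : 0 < k) (hδ : 0 < δ)
    (hρ : (4 * K / (η * l ^ 4) + 1) * (1 + C') * d * √k / δ ^ 2 ≤ ρ) (hz : 0 ≤ z) :
    K * d ^ 2 * (1 + ρ ^ 2 * (2 * k * z ^ 2))
      ≤ η * (l * ρ * (δ * max z (max √z (δ / (C' * √d * √k))))) ^ 4 := by
  set L := 4 * K / (η * l ^ 4) + 1 with hL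
  set M := max z (max √z (δ / (C' * √d * √k)))
  have one_le_L : 1 ≤ L := le_add_of_nonneg_left (by positivity)
  have four_mul_K_le : 4 * K ≤ η * l ^ 4 * L := by
    rw [hL, mul_add, mul_div_cancel₀ _ (by positivity), mul_one]
    exact le_add_of_nonneg_right (by positivity)
  have one_le : 1 ≤ 1 + C' := le_add_of_nonneg_right hC'.le
  have L_le : L ≤ L * (1 + C') := le_mul_of_one_le_right (by positivity) one_le
  have ρ_nonneg : 0 ≤ ρ := le_trans (by positivity) hρ
  have floor : L * √d ≤ ρ * (δ * M) :=
    (mul_sqrt_le_of_sample_size (by positivity) hk hδ hC' (by nlinarith) hρ).trans <| by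
      gcongr
      exact (le_max_right _ _).trans (le_max_right _ _)
  have constant_term : L * d ^ 2 ≤ (ρ * (δ * M)) ^ 4 :=
    calc L * d ^ 2 ≤ L ^ 4 * (√d ^ 2) ^ 2 := by
          rw [Real.sq_sqrt (by positivity)]
          gcongr
          exact le_self_pow₀ one_le_L (by norm_num)
      _ = (L * √d) ^ 4 := by ring
      _ ≤ (ρ * (δ * M)) ^ 4 := by gcongr
  have main_term : L * d ^ 2 * (ρ ^ 2 * (k * z ^ 2)) ≤ (ρ * (δ * M)) ^ 4 :=
    calc L * d ^ 2 * (ρ ^ 2 * (k * z ^ 2)) ≤ (L * (1 + C') * d) ^ 2 * (ρ ^ 2 * (k * z ^ 2)) := by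
          rw [mul_pow _ d]
          gcongr
          exact L_le.trans (le_self_pow₀ (one_le_L.trans L_le) two_ne_zero)
      _ ≤ (ρ * (δ * M)) ^ 4 := mul_sq_mul_sq_le_of_sample_size (by positivity) (by positivity)
          hk.le hδ hρ hz ((le_max_left _ _).trans (le_max_right _ _))
  calc K * d ^ 2 * (1 + ρ ^ 2 * (2 * k * z ^ 2))
      ≤ 4 * K * (d ^ 2 * (1 + ρ ^ 2 * (k * z ^ 2))) / 2 := by
        have : 0 ≤ K * d ^ 2 := by positivity
        nlinarith
    _ ≤ η * l ^ 4 * L * (d ^ 2 * (1 + ρ ^ 2 * (k * z ^ 2))) / 2 := by gcongr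
    _ = η * l ^ 4 * (L * d ^ 2 + L * d ^ 2 * (ρ ^ 2 * (k * z ^ 2))) / 2 := by ring
    _ ≤ η * l ^ 4 * ((ρ * (δ * M)) ^ 4 + (ρ * (δ * M)) ^ 4) / 2 := by gcongr
    _ = η * (l * ρ * (δ * M)) ^ 4 := by ring

end SampleSize

end OneBitSensing

open OneBitSensing in
theorem theorem2_general {η C' : ℝ} (hη : 0 < η) (hC' : 0 < C') :
    ∃ C : ℝ, 0 < C ∧
      ∀ (d₁ d₂ k m : ℕ) (δ : ℝ) (W W' : Matrix (Fin d₁) (Fin d₂) ℝ)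
        (Ω : Type*) [MeasurableSpace Ω] (P : Measure Ω) [IsProbabilityMeasure P]
        (x : Fin m → Ω → Fin d₁ → ℝ) (j : Fin m → Ω → Fin d₂),
        IsSample P x j → W ∈ normalizedRankLE d₁ d₂ k → W' ∈ normalizedRankLE d₁ d₂ k → 0 < δ →
        C * max (d₁ : ℝ) d₂ * d₂ * √(k : ℝ) / δ ^ 2 ≤ m →
        1 - η ≤ P.real {ω | ‖estimationError (fun i => x i ω) (fun i => j i ω) W W'‖
          ≤ δ * max ‖W - W'‖ (max √‖W - W'‖ (δ / (C' * √(max (d₁ : ℝ) d₂) * √(k : ℝ))))} := by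
  have lambda_pos : 0 < √(2 / Real.pi) := Real.sqrt_pos.2 (by positivity)
  refine ⟨(4 * 2404080 / (η * √(2 / Real.pi) ^ 4) + 1) * (1 + C'), by positivity, ?_⟩
  intro d₁ d₂ k m δ W W' Ω _ P _ x j h hW hW' hδ hm
  obtain rfl | hd₂ := eq_or_ne d₂ 0
  · refine (sub_le_self 1 hη.le).trans
      ((probReal_univ (μ := P)).ge.trans (measureReal_mono fun ω _ => ?_))
    rw [Set.mem_ofPred_eq, Subsingleton.elim (estimationError _ _ W W') 0, norm_zero]
    positivity
  have k_pos : (0 : ℝ) < k := mod_cast pos_of_mem_normalizedRankLE hd₂ hW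
  have one_le_max : 1 ≤ max (d₁ : ℝ) d₂ :=
    le_max_of_le_right (mod_cast Nat.one_le_iff_ne_zero.2 hd₂)
  have m_ne_zero : m ≠ 0 := Nat.cast_ne_zero.1 (lt_of_lt_of_le (by positivity) hm).ne'
  have sample_size : (4 * 2404080 / (η * √(2 / Real.pi) ^ 4) + 1) * (1 + C') * max (d₁ : ℝ) d₂
      * √(k : ℝ) / δ ^ 2 ≤ m / d₂ := by
    rw [le_div_iff₀ (by positivity)]
    exact le_of_eq_of_le (by ring) hm
  refine one_sub_le_measureReal_norm_estimationError_le hd₂ m_ne_zero h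
    (col_dotProduct_self_of_mem_normalizedRankLE hW)
    (col_dotProduct_self_of_mem_normalizedRankLE hW') (le_max_left _ _) (le_max_right _ _)
    (by positivity) (le_trans ?_ (moment_le_of_sample_size (by norm_num) lambda_pos hη hC'
      one_le_max k_pos hδ sample_size (norm_nonneg (W - W'))))
  gcongr
  exact sum_sum_sub_sq_le_of_mem_normalizedRankLE hW hW'

theorem theorem2 (η : ℝ) (hη : η ∈ Set.Ioo (0 : ℝ) 1) (C' : ℝ) (hC' : 0 < C') :
    ∃ C : ℝ, 0 < C ∧
      ∀ (d₁ d₂ k m : ℕ) (δ δ' : ℝ) (W W' : Matrix (Fin d₁) (Fin d₂) ℝ)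
        (Ω : Type*) [MeasurableSpace Ω] (P : Measure Ω) [IsProbabilityMeasure P]
        (x : Fin m → Ω → Fin d₁ → ℝ) (j : Fin m → Ω → Fin d₂),
        OneBitSensing.IsSample P x j →
        d₂ < d₁ →
        W ∈ OneBitSensing.normalizedRankLE d₁ d₂ k →
        W' ∈ OneBitSensing.normalizedRankLE d₁ d₂ k →
        W ≠ W' →
        0 < δ →
        C * d₁ * d₂ * √(k : ℝ) / δ ^ 2 ≤ (m : ℝ) →
        δ' = δ / (C' * √(d₁ : ℝ) * √(k : ℝ)) →
        1 - η ≤ P.real {ω |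
          ‖(√(d₂ : ℝ) / (√(2 / Real.pi) * m)) •
              (OneBitSensing.sensingAdjoint (fun i => x i ω) (fun i => j i ω)
                  (fun i => OneBitSensing.sign
                    (OneBitSensing.sensing (fun i => x i ω) (fun i => j i ω) W i)) -
                OneBitSensing.sensingAdjoint (fun i => x i ω) (fun i => j i ω)
                  (fun i => OneBitSensing.sign
                    (OneBitSensing.sensing (fun i => x i ω) (fun i => j i ω) W' i))) -
              (W - W')‖
            ≤ δ * max ‖W - W'‖ (max (√‖W - W'‖) δ')} := by
  obtain ⟨C, hC, general⟩ := theorem2_general hη.1 hC'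
  refine ⟨C, hC, fun d₁ d₂ k m δ δ' W W' Ω _ P _ x j h hd hW hW' _ hδ hm hδ' => ?_⟩
  rw [hδ', ← max_eq_left (Nat.cast_le.2 hd.le : (d₂ : ℝ) ≤ d₁)]
  exact general d₁ d₂ k m δ W W' Ω P x j h hW hW' hδ (by rwa [max_eq_left (mod_cast hd.le)])
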